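/- Let $Q$ be a prime power and let $\alpha\in\mathbb F_{Q^2}^*$. The polynomial $x^{2Q+3}+\alpha x$ permutes $\mathbb F_{Q^2}$ (that is, $c\mapsto c^{2Q+3}+\alpha c$ is a bijection of $\mathbb F_{Q^2}$) if and only if at least one of the following holds: 1. $Q\equiv\pm2\pmod 5$ and $\alpha^{2Q-2}-3\alpha^{Q-1}+1=0$; 2. $Q=5^n$ for some positive integer $n$, and either $\alpha^{Q-1}=-1$ or $\alpha^{(Q-1)/2}=-1$; 3. $Q=13$ and $\alpha^{12}-3\alpha^6+1=0$; 4. $Q=5$ and $\alpha^4-\alpha^2+1=0$; 5. $Q=3$ and either $\alpha=1$ or $\alpha^2=-1$. Moreover, whenever $Q$ satisfies the condition on $Q$ in the respective case, the number of elements $\alpha\in\mathbb F_{Q^2}$ having the stated property is $2Q-2$ in case (1), $3(Q-1)/2$ in case (2), $12$ in case (3), $4$ in case (4), and $3$ in case (5). -/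

import Mathlib

/-- A polynomial `f` over a (finite) field `K` is a permutation polynomial over `K` if the function
`c ↦ f(c)` is a permutation of `K`. -/
def IsPermutationPolynomial {K : Type*} [Field K] (f : Polynomial K) : Prop :=
  Function.Bijective (fun c : K => f.eval c)

/-! Put F = F_Q, and let T and N be the trace and norm of α to F. With y = x^(Q+1), the norm of x,
the polynomial takes the value f(x) = x(y² + α), whose norm is g(y) = y(y² + α)(y² + α^Q) = y⁵ + Ty³
+ Ny. Since f(zx) = z f(x) when z has norm 1, and the norm is onto, f permutes F_{Q²} exactly when g
is injective on F (`isPermutationPolynomial_iff`).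

Necessary conditions come from Hermite's criterion: if g permutes F_q, the sum of g(y)^t over F_q
vanishes for 0 < t < q - 1. If 5t is slightly above q - 1, only the coefficient of y^(q-1) survives,
and it is a short polynomial in T and N whose binomial coefficients are known because 5t ≡ c in F,
or because t is known modulo a power of p. This rules out q ≡ 1, forces T = 0 for q ≡ 4 (then a
contradiction), and yields T² = 5N for q ≡ ±2 (mod 5), apart from small q and the branch 2T² = 5N,
which only q = 13 or p = 17 permits. When T² = 5N, g is a Dickson polynomial, and T² - 5N =
α²(α^(2Q-2) - 3α^(Q-1) + 1). The converse rests on c² - 3c + 1 having no root in F, since its roots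
come from primitive fifth roots of unity.

In characteristic 5, g(x) - g(y) is d = x - y times a quartic in d and s = x + y that contains s
only through 2Ts². If T ≠ 0, injectivity says that a quadratic in d² takes only nonsquare values for
d ≠ 0; its power (q-1)/2 then equals -1 there, and comparing coefficients gives T² = 4N, so α lies
in F. The case T = 0 is α^(Q-1) = -1.

The fields with 3, 5 and 13 elements are settled directly. Each count holds because the polynomial
in α divides X^(Q²-1) - 1, so it has as many roots as its degree. -/

/-- The odd quintic `y ↦ y ^ 5 + T * y ^ 3 + N * y`. -/
def oddQuintic {F : Type*} [Field F] (T N y : F) : F := y ^ 5 + T * y ^ 3 + N * y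

/-! ### Powers of the odd quintic and Hermite's criterion -/

theorem oddQuintic_zero {F : Type*} [Field F] (T N : F) : oddQuintic T N 0 = 0 := by
  simp [oddQuintic]

/-- Here i counts the factors other than y⁵, and j those among them equal to Ny; each lowers the
exponent 5t by 2 or, for Ny, by 4. -/
theorem oddQuintic_pow {F : Type*} [Field F] (T N y : F) (t : ℕ) :
    oddQuintic T N y ^ t = ∑ i ∈ Finset.range (t + 1), ∑ j ∈ Finset.range (i + 1),
      (t.choose i * i.choose j * T ^ (i - j) * N ^ j) * y ^ (5 * t - 2 * (i + j)) := by
  have h : oddQuintic T N y = (N * y + T * y ^ 3) + y ^ 5 := by rw [oddQuintic]; ring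
  rw [h, add_pow]
  refine Finset.sum_congr rfl fun i hi => ?_
  rw [add_pow, Finset.sum_mul, Finset.sum_mul]
  refine Finset.sum_congr rfl fun j hj => ?_
  rw [Finset.mem_range] at hi hj
  have e : 5 * t - 2 * (i + j) = j + 3 * (i - j) + 5 * (t - i) := by omega
  rw [e, mul_pow, mul_pow, ← pow_mul, ← pow_mul, pow_add, pow_add]
  ring

theorem sum_pow_eq_ite {F : Type*} [Field F] [Fintype F] {k : ℕ} (hk : 0 < k) :
    ∑ y : F, y ^ k = if Fintype.card F - 1 ∣ k then -1 else 0 := by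
  classical
  rw [← FiniteField.sum_pow_units F k]
  rw [← Finset.sum_erase (f := fun y : F => y ^ k) Finset.univ (a := 0) (zero_pow hk.ne')]
  symm
  refine Finset.sum_bij (fun u _ => (u : F)) (by simp) (by simp [Units.ext_iff]) ?_ (by simp)
  intro b hb
  exact ⟨Units.mk0 b (by simpa using hb), by simp, rfl⟩

/-- Hermite's criterion for an odd quintic. -/
theorem hermite_oddQuintic {F : Type*} [Field F] [Fintype F] {T N : F}
    (hg : Function.Injective (oddQuintic T N)) {t : ℕ} (ht : 0 < t)
    (htq : t < Fintype.card F - 1) :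
    ∑ i ∈ Finset.range (t + 1), ∑ j ∈ Finset.range (i + 1),
      (if Fintype.card F - 1 ∣ 5 * t - 2 * (i + j) then
        (t.choose i * i.choose j * T ^ (i - j) * N ^ j) else 0) = 0 := by
  have h1 : ∑ y : F, oddQuintic T N y ^ t = 0 := by
    rw [← FiniteField.sum_pow_lt_card_sub_one F t htq]
    exact (Finite.injective_iff_bijective.1 hg).sum_comp (fun y => y ^ t)
  simp_rw [oddQuintic_pow] at h1
  rw [Finset.sum_comm, ← neg_eq_zero] at h1
  refine Eq.trans ?_ h1
  rw [← Finset.sum_neg_distrib]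
  refine Finset.sum_congr rfl fun i hi => ?_
  rw [Finset.sum_comm, ← Finset.sum_neg_distrib]
  refine Finset.sum_congr rfl fun j hj => ?_
  rw [Finset.mem_range] at hi hj
  rw [← Finset.mul_sum, sum_pow_eq_ite (by omega)]
  split_ifs <;> simp

theorem sum_range_range_eq_antidiagonal {M : Type*} [AddCommMonoid M] (f : ℕ → ℕ → M) (t k : ℕ)
    (hf : ∀ i j, t < i ∨ i < j → f i j = 0) :
    ∑ i ∈ Finset.range (t + 1), ∑ j ∈ Finset.range (i + 1), (if i + j = k then f i j else 0) =
      ∑ x ∈ Finset.HasAntidiagonal.antidiagonal k, f x.1 x.2 := by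
  rw [Finset.sum_sigma', ← Finset.sum_filter]
  refine Finset.sum_bij_ne_zero (fun a _ _ => (a.1, a.2)) ?_ ?_ ?_ ?_
  · simp +contextual
  · rintro ⟨a, b⟩ _ _ ⟨c, d⟩ _ _ h
    simpa using h
  · rintro ⟨a, b⟩ h1 h2
    refine ⟨⟨a, b⟩, ?_, h2, rfl⟩
    have := mt (hf a b) h2
    simp at h1 ⊢
    omega
  · simp

/-- `hk` makes i + j = k the terms of exponent q - 1. The exponent is at least t > 0, `h3` excludes
3(q-1) and above, and `h2` excludes 2(q-1), so no other multiple of q - 1 contributes. -/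
theorem hermite_coeff {F : Type*} [Field F] [Fintype F] {T N : F}
    (hg : Function.Injective (oddQuintic T N)) {q t k : ℕ} (hq : Fintype.card F = q) (ht : 0 < t)
    (htq : t < q - 1) (hk : 2 * k + (q - 1) = 5 * t) (h3 : 5 * t < 3 * (q - 1))
    (h2 : ∀ l, 2 * l + 2 * (q - 1) ≠ 5 * t) :
    ∑ x ∈ Finset.HasAntidiagonal.antidiagonal k,
      ((t.choose x.1 * x.1.choose x.2 : F) * T ^ (x.1 - x.2) * N ^ x.2) = 0 := by
  rw [← hermite_oddQuintic hg ht (by omega), hq, ← sum_range_range_eq_antidiagonal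
    (fun i j => (t.choose i * i.choose j : F) * T ^ (i - j) * N ^ j) t k]
  · refine Finset.sum_congr rfl fun i hi => Finset.sum_congr rfl fun j hj => ?_
    rw [Finset.mem_range] at hi hj
    refine if_congr ?_ rfl rfl
    constructor
    · rintro h
      exact ⟨1, by omega⟩
    · rintro ⟨c, hc⟩
      have := h2 (i + j)
      rcases c with _ | _ | _ | c
      · omega
      · omega
      · omega
      · have : (q - 1) * (c + 1 + 1 + 1) = (q - 1) * c + 3 * (q - 1) := by ring
        omega
  · rintro i j (h | h)
    · simp [Nat.choose_eq_zero_of_lt h]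
    · simp [Nat.choose_eq_zero_of_lt h]

/-- For T = 0 only i = j survives, so exponents move in steps of 4 and the relation is a single
monomial in N. The weaker `h2` admits values of t that `hermite_coeff` does not. -/
theorem hermite_coeff_zero {F : Type*} [Field F] [Fintype F] {N : F}
    (hg : Function.Injective (oddQuintic 0 N)) {q t i : ℕ} (hq : Fintype.card F = q) (ht : 0 < t)
    (htq : t < q - 1) (hi : 4 * i + (q - 1) = 5 * t) (h3 : 5 * t < 3 * (q - 1))
    (h2 : ∀ l, 4 * l + 2 * (q - 1) ≠ 5 * t) :
    (t.choose i : F) * N ^ i = 0 := by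
  have key := hermite_oddQuintic hg ht (by omega)
  have : ∀ a ∈ Finset.range (t + 1), ∑ j ∈ Finset.range (a + 1),
      (if Fintype.card F - 1 ∣ 5 * t - 2 * (a + j) then
        (t.choose a * a.choose j * (0 : F) ^ (a - j) * N ^ j) else 0) =
      if a = i then (t.choose i : F) * N ^ i else 0 := by
    intro a ha
    rw [Finset.mem_range] at ha
    rw [Finset.sum_range_succ, Finset.sum_eq_zero, zero_add]
    · rw [hq]
      have : (q - 1 ∣ 5 * t - 2 * (a + a)) ↔ a = i := by
        constructor
        · rintro ⟨c, hc⟩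
          have := h2 a
          rcases c with _ | _ | _ | c
          · omega
          · omega
          · omega
          · have : (q - 1) * (c + 1 + 1 + 1) = (q - 1) * c + 3 * (q - 1) := by ring
            omega
        · rintro h
          exact ⟨1, by omega⟩
      simp only [this]
      split_ifs with h
      · simp [h]
      · rfl
    · intro j hj
      rw [Finset.mem_range] at hj
      rw [zero_pow (by omega)]
      simp
  rw [Finset.sum_congr rfl this, Finset.sum_ite_eq'] at key
  rwa [if_pos (by rw [Finset.mem_range]; omega)] at key

/-! ### Binomial coefficients in characteristic p -/

theorem cast_choose_succ {F : Type*} [Field F] (t i : ℕ) :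
    (t.choose (i + 1) : F) * (i + 1) = t.choose i * (t - i) := by
  rcases le_or_gt i t with h | h
  · have := congrArg (Nat.cast (R := F)) (Nat.choose_succ_right_eq t i)
    push_cast [Nat.cast_sub h] at this
    exact this
  · simp [Nat.choose_eq_zero_of_lt h, Nat.choose_eq_zero_of_lt (h.trans (Nat.lt_succ_self i))]

/-- Lucas' theorem: for i < p^e only the lowest e base-p digits of the upper argument matter. -/
theorem choose_modEq_of_lt {p : ℕ} [Fact p.Prime] (e : ℕ) : ∀ {s t i : ℕ}, i < p ^ e →
    (p ^ e * s + t).choose i ≡ t.choose i [MOD p] := by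
  induction e with
  | zero =>
    intro s t i h
    have : i = 0 := by simpa using h
    subst this
    simp [Nat.ModEq]
  | succ e ih =>
    intro s t i h
    have hp : 0 < p := (Fact.out : p.Prime).pos
    refine (Choose.choose_modEq_choose_mod_mul_choose_div_nat (p := p)).trans
      (Nat.ModEq.trans ?_ (Choose.choose_modEq_choose_mod_mul_choose_div_nat (p := p)).symm)
    have e1 : p ^ (e + 1) * s + t = p * (p ^ e * s) + t := by ring
    rw [e1, Nat.mul_add_mod, Nat.mul_add_div hp]
    exact Nat.ModEq.mul_left _ (ih (Nat.div_lt_of_lt_mul (by rwa [pow_succ'] at h)))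

theorem cast_choose_eq_of_mod {F : Type*} [Field F] (p : ℕ) [Fact p.Prime] [CharP F p] (e : ℕ)
    {m t t₀ i : ℕ} (hm : p ^ e = m) (ht : t % m = t₀) (hi : i < m) :
    (t.choose i : F) = t₀.choose i := by
  apply CharP.natCast_eq_natCast' F p
  subst hm
  have := choose_modEq_of_lt (p := p) e (s := t / p ^ e) (t := t % p ^ e) hi
  rw [Nat.div_add_mod] at this
  rw [ht] at this
  exact this

/-- One step of the recursion for binomial coefficients at t = c/5, with denominators cleared: d and
d' are powers of 5, and r is what must be invertible to divide by i + 1. -/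
theorem cast_choose_succ_eq {F : Type*} [Field F] {t i c : ℕ} {d d' r a b : F} (hc : 5 * (t : F) = c)
    (ha : d * t.choose i = a) (hb : a * (c - 5 * i) = r * b) (hd : 5 * (i + 1) * d = r * d')
    (hr : r ≠ 0) : d' * (t.choose (i + 1) : F) = b := by
  apply mul_left_cancel₀ hr
  rw [← hb, ← ha, ← mul_assoc, ← hd, ← hc]
  linear_combination 5 * d * cast_choose_succ (F := F) t i

theorem cast_ne_zero_of_lt {F : Type*} [Field F] (p : ℕ) [CharP F p] {r : ℕ} (h0 : 0 < r) (h : r < p) :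
    (r : F) ≠ 0 := by
  rw [Ne, CharP.cast_eq_zero_iff F p]
  exact Nat.not_dvd_of_pos_of_lt h0 h

/-! ### Necessity for q ≡ 1 and q ≡ 4 (mod 5) -/

section Necessity

variable {F : Type*} [Field F] [Fintype F] {T N : F} {q : ℕ}

/-- For t = (q-1)/5 the exponent q - 1 is the leading one, with coefficient 1. -/
theorem not_injective_oddQuintic_of_mod_one (hq : Fintype.card F = q) (h5 : q % 5 = 1)
    (hq1 : 1 < q) : ¬ Function.Injective (oddQuintic T N) := by
  intro hg
  have := hermite_coeff hg (q := q) (t := (q - 1) / 5) (k := 0) hq (by omega) (by omega) (by omega)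
    (by omega) (by omega)
  simp at this

theorem five_mul_cast {t c : ℕ} (hq : Fintype.card F = q) (h : 5 * t = q + c) :
    5 * (t : F) = c := by
  have := congrArg (Nat.cast (R := F)) h
  push_cast at this
  rwa [← hq, FiniteField.cast_card_eq_zero, zero_add] at this

theorem eq_zero_of_mod_four (hq : Fintype.card F = q) (h5 : q % 5 = 4)
    (hg : Function.Injective (oddQuintic T N)) : T = 0 := by
  have key := hermite_coeff hg (q := q) (t := (q + 1) / 5) (k := 1) hq (by omega) (by omega)
    (by omega) (by omega) (by omega)
  have ht : 5 * (((q + 1) / 5 : ℕ) : F) = 1 := by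
    simpa using five_mul_cast (F := F) (t := (q + 1) / 5) (c := 1) hq (by omega)
  simp [Finset.Nat.antidiagonal_succ] at key
  rcases key with h | h
  · simp [h] at ht
  · exact h

theorem card_eq_nine_of_mod_four (p : ℕ) [Fact p.Prime] [CharP F p] {n : ℕ} (hqn : q = p ^ n)
    (hq : Fintype.card F = q) (h5 : q % 5 = 4) (hN : N ≠ 0)
    (hg : Function.Injective (oddQuintic T N)) : q = 9 := by
  obtain rfl := eq_zero_of_mod_four hq h5 hg
  have hp : p.Prime := Fact.out
  by_contra h9
  rcases eq_or_ne p 2 with rfl | hp2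
  -- Squaring is bijective in characteristic 2, so N = b⁴, and then g(b) = 2b⁵ = 0 = g(0).
  · have hr := FiniteField.pow_card N
    obtain ⟨a, ha⟩ : ∃ a : F, a ^ 2 = N := ⟨N ^ (q / 2), by
      have : q / 2 * 2 = q := by
        have : n ≠ 0 := by rintro rfl; simp [hqn] at h5
        have : 2 ∣ q := hqn ▸ dvd_pow_self 2 this
        omega
      rw [← pow_mul, this, ← hq, hr]⟩
    obtain ⟨b, hb⟩ : ∃ b : F, b ^ 2 = a := ⟨a ^ (q / 2), by
      have : q / 2 * 2 = q := by
        have : n ≠ 0 := by rintro rfl; simp [hqn] at h5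
        have : 2 ∣ q := hqn ▸ dvd_pow_self 2 this
        omega
      rw [← pow_mul, this, ← hq, FiniteField.pow_card]⟩
    have h2 : (2 : F) = 0 := by exact_mod_cast CharP.cast_eq_zero F 2
    have : b = 0 := hg (by
      rw [oddQuintic_zero, oddQuintic, ← ha, ← hb]
      linear_combination b ^ 5 * h2)
    exact hN (by rw [← ha, ← hb, this]; simp)
  have hodd : q % 2 = 1 := by
    rw [hqn]
    exact Nat.odd_iff.1 ((hp.odd_of_ne_two hp2).pow)
  -- The relation is C(t,3)N³ = 0. Away from p = 2, 3, 5 one has 125·C(t,3) = 11, which leaves p =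
  -- 11, whose powers are 1 mod 5. For q = 9 the exponent 2(q-1) interferes, hence the exception.
  have key := hermite_coeff_zero hg (q := q) (t := (q + 11) / 5) (i := 3) hq (by omega) (by omega)
    (by omega) (by omega) (by omega)
  have hC : (((q + 11) / 5).choose 3 : F) = 0 := by simpa [hN] using key
  have hp5 : p ≠ 5 := by
    rintro rfl
    have : n ≠ 0 := by rintro rfl; simp [hqn] at h5
    have : 5 ∣ q := hqn ▸ dvd_pow_self 5 this
    omega
  rcases eq_or_ne p 3 with rfl | hp3
  · have h9q : 9 ∣ q := by
      have : 2 ≤ n := by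
        by_contra h
        interval_cases n <;> simp [hqn] at h5
      rw [hqn]
      exact pow_dvd_pow 3 this
    rw [cast_choose_eq_of_mod 3 2 (m := 9) (t₀ := 4) (by norm_num) (by omega) (by norm_num)] at hC
    have h3 : (3 : F) = 0 := by exact_mod_cast CharP.cast_eq_zero F 3
    have : Nat.choose 4 3 = 4 := by decide
    rw [this] at hC
    push_cast at hC
    exact one_ne_zero (α := F) (by linear_combination hC - h3)
  · have ht : 5 * (((q + 11) / 5 : ℕ) : F) = (11 : ℕ) :=
      five_mul_cast hq (by omega)
    have h2' : (2 : F) ≠ 0 := by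
      exact_mod_cast cast_ne_zero_of_lt (F := F) p (r := 2) (by norm_num)
        (by have := hp.two_le; omega)
    have h3' : (3 : F) ≠ 0 := by
      exact_mod_cast cast_ne_zero_of_lt (F := F) p (r := 3) (by norm_num)
        (by have := hp.two_le; omega)
    have c0 : (1 : F) * (((q + 11) / 5).choose 0 : F) = 1 := by simp
    have c1 := cast_choose_succ_eq (r := 1) (d' := 5) (b := 11) ht c0 (by norm_num) (by norm_num)
      one_ne_zero
    have c2 := cast_choose_succ_eq (r := 2) (d' := 25) (b := 33) ht c1 (by norm_num) (by norm_num) h2'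
    have c3 := cast_choose_succ_eq (r := 3) (d' := 125) (b := 11) ht c2 (by norm_num) (by norm_num)
      h3'
    rw [hC, mul_zero] at c3
    have h11 : p ∣ 11 := (CharP.cast_eq_zero_iff F p 11).1 (by exact_mod_cast c3.symm)
    rw [(Nat.prime_dvd_prime_iff_eq hp (by norm_num))] at h11
    subst h11
    have : q % 5 = 1 := by rw [hqn, Nat.pow_mod]; simp
    omega

end Necessity

/-! ### Necessity for q ≡ 2 (mod 5) -/

section Necessity

variable {F : Type*} [Field F] [Fintype F] {T N : F} {q : ℕ}

theorem hermite_coeff_two (hg : Function.Injective (oddQuintic T N)) (hq : Fintype.card F = q)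
    {t : ℕ} (ht : 5 * t = q + 3) (hq6 : 6 ≤ q) :
    (t.choose 1 : F) * N + t.choose 2 * T ^ 2 = 0 := by
  have := hermite_coeff hg (q := q) (t := t) (k := 2) hq (by omega) (by omega) (by omega) (by omega)
    (by omega)
  rw [Finset.Nat.sum_antidiagonal_eq_sum_range_succ_mk] at this
  norm_num [Finset.sum_range_succ, Nat.choose_eq_zero_of_lt] at this
  norm_num
  linear_combination this

theorem hermite_coeff_four (hg : Function.Injective (oddQuintic T N)) (hq : Fintype.card F = q)
    {t : ℕ} (ht : 5 * t = q + 7) (hq6 : 6 ≤ q) :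
    (t.choose 2 : F) * N ^ 2 + t.choose 3 * 3 * T ^ 2 * N + t.choose 4 * T ^ 4 = 0 := by
  have := hermite_coeff hg (q := q) (t := t) (k := 4) hq (by omega) (by omega) (by omega) (by omega)
    (by omega)
  rw [Finset.Nat.sum_antidiagonal_eq_sum_range_succ_mk] at this
  norm_num [Finset.sum_range_succ, Nat.choose_eq_zero_of_lt, show Nat.choose 5 2 = 10 from rfl,
    show Nat.choose 6 3 = 20 from rfl, show Nat.choose 7 2 = 21 from rfl] at this
  linear_combination this

theorem hermite_coeff_seven (hg : Function.Injective (oddQuintic T N)) (hq : Fintype.card F = q)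
    {t : ℕ} (ht : 5 * t = q + 13) (hq16 : 16 ≤ q) :
    (t.choose 4 : F) * 4 * T * N ^ 3 + t.choose 5 * 10 * T ^ 3 * N ^ 2 +
      t.choose 6 * 6 * T ^ 5 * N + t.choose 7 * T ^ 7 = 0 := by
  have := hermite_coeff hg (q := q) (t := t) (k := 7) hq (by omega) (by omega) (by omega) (by omega)
    (by omega)
  rw [Finset.Nat.sum_antidiagonal_eq_sum_range_succ_mk] at this
  norm_num [Finset.sum_range_succ, Nat.choose_eq_zero_of_lt, show Nat.choose 5 2 = 10 from rfl,
    show Nat.choose 6 3 = 20 from rfl, show Nat.choose 7 2 = 21 from rfl] at this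
  linear_combination this

theorem hermite_coeff_nine (hg : Function.Injective (oddQuintic T N)) (hq : Fintype.card F = q)
    {t : ℕ} (ht : 5 * t = q + 17) (hq20 : 20 ≤ q) :
    (t.choose 5 : F) * 5 * T * N ^ 4 + t.choose 6 * 20 * T ^ 3 * N ^ 3 +
      t.choose 7 * 21 * T ^ 5 * N ^ 2 + t.choose 8 * 8 * T ^ 7 * N + t.choose 9 * T ^ 9 = 0 := by
  have := hermite_coeff hg (q := q) (t := t) (k := 9) hq (by omega) (by omega) (by omega) (by omega)
    (by omega)
  rw [Finset.Nat.sum_antidiagonal_eq_sum_range_succ_mk] at this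
  norm_num [Finset.sum_range_succ, Nat.choose_eq_zero_of_lt, show Nat.choose 5 2 = 10 from rfl,
    show Nat.choose 6 3 = 20 from rfl, show Nat.choose 7 2 = 21 from rfl] at this
  linear_combination this

theorem three_pow_mod_four {n : ℕ} (h : 3 ^ n % 5 = 2) : 3 ^ n % 4 = 3 := by
  obtain ⟨k, r, hr, rfl⟩ : ∃ k r, r < 4 ∧ n = 4 * k + r :=
    ⟨n / 4, n % 4, Nat.mod_lt _ (by norm_num), (Nat.div_add_mod n 4).symm⟩
  rw [pow_add, pow_mul, Nat.mul_mod, Nat.pow_mod] at h ⊢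
  interval_cases r <;> first | (norm_num at h; done) | norm_num

/-- With t = (q+43)/5 ≡ 14 mod 27, C(t,11) ≡ 364 ≡ 1 mod 3. That q ≡ 3 mod 4 keeps the exponent
2(q-1) from occurring. -/
theorem eq_zero_of_char_three_of_dvd [CharP F 3] (hq : Fintype.card F = q) (h5 : q % 5 = 2)
    (hq4 : q % 4 = 3) (h27 : 27 ∣ q) (hg : Function.Injective (oddQuintic 0 N)) : N = 0 := by
  obtain ⟨t, ht⟩ : ∃ t, 5 * t = q + 43 := ⟨(q + 43) / 5, by omega⟩
  have h0 : 27 ≤ q := Nat.le_of_dvd (by omega) h27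
  have hi : 4 * 11 + (q - 1) = 5 * t := by omega
  have htq : t < q - 1 := by omega
  have h14 : t % 27 = 14 := by omega
  have h2 : ∀ l, 4 * l + 2 * (q - 1) ≠ 5 * t := by
    clear h14
    intro l hl
    omega
  have key := hermite_coeff_zero hg hq (by omega) htq hi (by omega) h2
  have hC : (t.choose 11 : F) = (14 : ℕ).choose 11 :=
    cast_choose_eq_of_mod 3 3 (m := 27) (by norm_num) h14 (by norm_num)
  have h364 : Nat.choose 14 11 = 364 := by
    rw [Nat.choose_symm_of_eq_add (b := 3) rfl]
    rfl
  rw [hC, h364] at key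
  push_cast at key
  have h3 : (3 : F) = 0 := by exact_mod_cast CharP.cast_eq_zero F 3
  have : N ^ 11 = 0 := by linear_combination key - 121 * N ^ 11 * h3
  exact (pow_eq_zero_iff (by norm_num)).1 this

/-- The k = 2 relation degenerates modulo 3, so k = 7 is used, where t ≡ 8 mod 9. -/
theorem sq_eq_of_mod_two_of_char_three [CharP F 3] {n : ℕ} (hqn : q = 3 ^ n)
    (hq : Fintype.card F = q) (h5 : q % 5 = 2) (hN : N ≠ 0)
    (hg : Function.Injective (oddQuintic T N)) : T ^ 2 = 5 * N := by
  have h27 : 27 ∣ q := by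
    have : 3 ≤ n := by
      by_contra h
      interval_cases n <;> simp [hqn] at h5
    have : 3 ^ 3 ∣ 3 ^ n := pow_dvd_pow 3 this
    rw [hqn]
    norm_num at this
    exact this
  have h9 : 9 ∣ q := Dvd.dvd.trans (by norm_num) h27
  have hq4 : q % 4 = 3 := by
    rw [hqn] at h5 ⊢
    exact three_pow_mod_four h5
  have h3 : (3 : F) = 0 := by exact_mod_cast CharP.cast_eq_zero F 3
  have hT : T ≠ 0 := by
    rintro rfl
    exact hN (eq_zero_of_char_three_of_dvd hq h5 hq4 h27 hg)
  obtain ⟨t, ht⟩ : ∃ t, 5 * t = q + 13 := ⟨(q + 13) / 5, by omega⟩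
  have key := hermite_coeff_seven hg hq ht (by omega)
  have hC (i : ℕ) (hi : i < 9) : (t.choose i : F) = (8 : ℕ).choose i :=
    cast_choose_eq_of_mod 3 2 (m := 9) (by norm_num) (by omega) hi
  rw [hC 4 (by norm_num), hC 5 (by norm_num), hC 6 (by norm_num), hC 7 (by norm_num)] at key
  rw [show Nat.choose 8 4 = 70 from rfl, show Nat.choose 8 5 = 56 from rfl,
    show Nat.choose 8 6 = 28 from rfl, show Nat.choose 8 7 = 8 from rfl] at key
  push_cast at key
  have key2 : T * ((N + T ^ 2) * ((N - T ^ 2) ^ 2 + T ^ 4)) = 0 := by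
    linear_combination key - (93 * T * N ^ 3 + 187 * T ^ 3 * N ^ 2 + 56 * T ^ 5 * N +
      2 * T ^ 7) * h3
  rcases mul_eq_zero.1 ((mul_eq_zero.1 key2).resolve_left hT) with h | h
  · linear_combination h - 2 * N * h3
  · exfalso
    -- The other factor is a sum of two squares with T ≠ 0; q ≡ 3 mod 4 makes -1 a nonsquare.
    have : IsSquare (-1 : F) := ⟨(N - T ^ 2) / T ^ 2, by
      field_simp
      linear_combination -h⟩
    rw [FiniteField.isSquare_neg_one_iff, hq] at this
    exact this hq4

/-- For `q ≡ 2 (mod 5)` an injective odd quintic is a Dickson polynomial. -/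
theorem sq_eq_of_mod_two (p : ℕ) [Fact p.Prime] [CharP F p] {n : ℕ} (hqn : q = p ^ n)
    (hq : Fintype.card F = q) (h5 : q % 5 = 2) (hq2 : q ≠ 2) (hN : N ≠ 0)
    (hg : Function.Injective (oddQuintic T N)) : T ^ 2 = 5 * N := by
  have hp : p.Prime := Fact.out
  obtain ⟨t, ht⟩ : ∃ t, 5 * t = q + 3 := ⟨(q + 3) / 5, by omega⟩
  have key := hermite_coeff_two hg hq ht (by omega)
  rcases eq_or_ne p 2 with rfl | hp2
  · have h4 : 4 ∣ q := by
      have : 2 ≤ n := by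
        by_contra h
        interval_cases n <;> simp [hqn] at h5 hq2
      rw [hqn]
      exact pow_dvd_pow 2 this
    have hC (i : ℕ) (hi : i < 4) : (t.choose i : F) = (3 : ℕ).choose i :=
      cast_choose_eq_of_mod 2 2 (m := 4) (by norm_num) (by omega) hi
    rw [hC 1 (by norm_num), hC 2 (by norm_num)] at key
    norm_num at key
    have h2 : (2 : F) = 0 := by exact_mod_cast CharP.cast_eq_zero F 2
    linear_combination key - (T ^ 2 + 4 * N) * h2
  rcases eq_or_ne p 3 with rfl | hp3
  · exact sq_eq_of_mod_two_of_char_three hqn hq h5 hN hg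
  have hp5 : 5 < p := by
    have : p ≠ 5 := by
      rintro rfl
      have : n ≠ 0 := by rintro rfl; simp [hqn] at h5
      have : 5 ∣ q := hqn ▸ dvd_pow_self 5 this
      omega
    have : p ≠ 4 := by rintro rfl; norm_num at hp
    have := hp.two_le
    omega
  have h5t := five_mul_cast hq ht
  have h2' : (2 : F) ≠ 0 := by
    exact_mod_cast cast_ne_zero_of_lt (F := F) p (r := 2) (by norm_num) (by omega)
  have h3' : (3 : F) ≠ 0 := by
    exact_mod_cast cast_ne_zero_of_lt (F := F) p (r := 3) (by norm_num) (by omega)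
  have c0 : (1 : F) * (t.choose 0 : F) = 1 := by simp
  have c1 := cast_choose_succ_eq (r := 1) (d' := 5) (b := 3) h5t c0 (by norm_num) (by norm_num)
    one_ne_zero
  have c2 := cast_choose_succ_eq (r := 2) (d' := 25) (b := -3) h5t c1 (by norm_num) (by norm_num)
    h2'
  apply mul_left_cancel₀ h3'
  norm_num at c1 c2 key
  linear_combination -25 * key + 5 * N * c1 + T ^ 2 * c2

end Necessity

/-! ### Necessity for q ≡ 3 (mod 5) -/

section Necessity

variable {F : Type*} [Field F] [Fintype F] {T N : F} {q : ℕ}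

theorem sq_eq_of_mod_three_of_char_two [CharP F 2] {n : ℕ} (hqn : q = 2 ^ n)
    (hq : Fintype.card F = q) (h5 : q % 5 = 3) (hN : N ≠ 0)
    (hg : Function.Injective (oddQuintic T N)) : T ^ 2 = 5 * N := by
  have h8 : 8 ∣ q := by
    have : 3 ≤ n := by
      by_contra h
      interval_cases n <;> simp [hqn] at h5
    have : 2 ^ 3 ∣ 2 ^ n := pow_dvd_pow 2 this
    rw [hqn]
    norm_num at this
    exact this
  clear hqn
  obtain ⟨t, ht⟩ : ∃ t, 5 * t = q + 7 := ⟨(q + 7) / 5, by omega⟩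
  have key := hermite_coeff_four hg hq ht (by omega)
  have hC (i : ℕ) (hi : i < 8) : (t.choose i : F) = (3 : ℕ).choose i :=
    cast_choose_eq_of_mod 2 3 (m := 8) (by norm_num) (by clear key; omega) hi
  rw [hC 2 (by norm_num), hC 3 (by norm_num), hC 4 (by norm_num)] at key
  rw [show Nat.choose 3 2 = 3 from rfl, show Nat.choose 3 3 = 1 from rfl,
    show Nat.choose 3 4 = 0 from rfl] at key
  push_cast at key
  have h2 : (2 : F) = 0 := by exact_mod_cast CharP.cast_eq_zero F 2
  have : N * (T ^ 2 - 5 * N) = 0 := by linear_combination key - (T ^ 2 * N + 4 * N ^ 2) * h2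
  exact sub_eq_zero.1 ((mul_eq_zero.1 this).resolve_left hN)

theorem sq_eq_of_mod_three_of_char_three [CharP F 3] {n : ℕ} (hqn : q = 3 ^ n)
    (hq : Fintype.card F = q) (h5 : q % 5 = 3) (hq3 : q ≠ 3) (hN : N ≠ 0)
    (hg : Function.Injective (oddQuintic T N)) : T ^ 2 = 5 * N := by
  have h27 : 27 ∣ q := by
    have : 3 ≤ n := by
      by_contra h
      interval_cases n <;> simp [hqn] at h5 hq3
    have : 3 ^ 3 ∣ 3 ^ n := pow_dvd_pow 3 this
    rw [hqn]
    norm_num at this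
    exact this
  clear hqn
  have h3 : (3 : F) = 0 := by exact_mod_cast CharP.cast_eq_zero F 3
  have hT : T ≠ 0 := by
    rintro rfl
    obtain ⟨t, ht⟩ : ∃ t, 5 * t = q + 7 := ⟨(q + 7) / 5, by omega⟩
    have key := hermite_coeff_four hg hq ht (by omega)
    have hC : (t.choose 2 : F) = (5 : ℕ).choose 2 :=
      cast_choose_eq_of_mod 3 2 (m := 9) (by norm_num) (by clear key; omega) (by norm_num)
    rw [hC, show Nat.choose 5 2 = 10 from rfl] at key
    push_cast at key
    have : N ^ 2 = 0 := by linear_combination key - 3 * N ^ 2 * h3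
    exact hN (pow_eq_zero_iff (by norm_num) |>.1 this)
  obtain ⟨t, ht⟩ : ∃ t, 5 * t = q + 17 := ⟨(q + 17) / 5, by omega⟩
  have key := hermite_coeff_nine hg hq ht (by omega)
  have h25 : t % 27 = 25 := by clear key; omega
  have hC (i a : ℕ) (hi : i < 27) (ha : Nat.choose 25 i ≡ a [MOD 3]) : (t.choose i : F) = a :=
    (cast_choose_eq_of_mod 3 3 (m := 27) (by norm_num) h25 hi).trans
      (CharP.natCast_eq_natCast' F 3 ha)
  rw [hC 5 0 (by norm_num) (by simp [Nat.choose, Nat.ModEq]),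
    hC 6 1 (by norm_num) (by simp [Nat.choose, Nat.ModEq]),
    hC 7 1 (by norm_num) (by simp [Nat.choose, Nat.ModEq]),
    hC 8 0 (by norm_num) (by simp [Nat.choose, Nat.ModEq]),
    hC 9 2 (by norm_num) (by simp [Nat.choose, Nat.ModEq])] at key
  push_cast at key
  have key2 : T ^ 3 * (N + T ^ 2) ^ 3 = 0 := by
    linear_combination 2 * key - (13 * T ^ 3 * N ^ 3 + 13 * T ^ 5 * N ^ 2 - T ^ 7 * N + T ^ 9) * h3
  have := pow_eq_zero_iff (by norm_num) |>.1
    ((mul_eq_zero.1 key2).resolve_left (pow_ne_zero 3 hT))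
  linear_combination this - 2 * N * h3

theorem eq_zero_of_char_seven_of_dvd [Fact (Nat.Prime 7)] [CharP F 7] (hq : Fintype.card F = q)
    (h5 : q % 5 = 3) (h49 : 49 ∣ q)
    (hg : Function.Injective (oddQuintic 0 N)) : N = 0 := by
  obtain ⟨t, ht⟩ : ∃ t, 5 * t = q + 27 := ⟨(q + 27) / 5, by omega⟩
  have h0 : 49 ≤ q := Nat.le_of_dvd (by omega) h49
  have h25 : t % 49 = 25 := by clear h5; omega
  clear h5 h49
  have key : (t.choose 7 : F) * N ^ 7 = 0 := by
    clear h25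
    exact hermite_coeff_zero hg hq (by omega) (by omega) (by omega) (by omega)
      (fun l hl => by omega)
  have hC : (t.choose 7 : F) = (25 : ℕ).choose 7 :=
    cast_choose_eq_of_mod 7 2 (m := 49) (by norm_num) h25 (by norm_num)
  have h3 : Nat.choose 25 7 = 7 * 68671 + 3 := by simp [Nat.choose]
  rw [hC, h3] at key
  push_cast at key
  have h7 : (7 : F) = 0 := by exact_mod_cast CharP.cast_eq_zero F 7
  have : N ^ 7 = 0 := by linear_combination 5 * key - (2 + 5 * 68671) * N ^ 7 * h7
  exact (pow_eq_zero_iff (by norm_num)).1 this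

/-- The generic k = 4 relation carries a factor 7 and says nothing here; k = 9 with t ≡ 23 mod 49
replaces it. -/
theorem sq_eq_of_mod_three_of_char_seven [Fact (Nat.Prime 7)] [CharP F 7] {n : ℕ} (hqn : q = 7 ^ n)
    (hq : Fintype.card F = q) (h5 : q % 5 = 3) (hN : N ≠ 0)
    (hg : Function.Injective (oddQuintic T N)) : T ^ 2 = 5 * N := by
  have h49 : 49 ∣ q := by
    have : 2 ≤ n := by
      by_contra h
      interval_cases n <;> simp [hqn] at h5
    have : 7 ^ 2 ∣ 7 ^ n := pow_dvd_pow 7 this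
    rw [hqn]
    norm_num at this
    exact this
  clear hqn
  have h7 : (7 : F) = 0 := by exact_mod_cast CharP.cast_eq_zero F 7
  have hT : T ≠ 0 := by
    rintro rfl
    exact hN (eq_zero_of_char_seven_of_dvd hq h5 h49 hg)
  obtain ⟨t, ht⟩ : ∃ t, 5 * t = q + 17 := ⟨(q + 17) / 5, by omega⟩
  have h0 : 49 ≤ q := Nat.le_of_dvd (by omega) h49
  have h23 : t % 49 = 23 := by clear h5 h0; omega
  have key := hermite_coeff_nine hg hq ht (by clear h5 h23 h49; omega)
  have hC (i a : ℕ) (hi : i < 49) (ha : Nat.choose 23 i ≡ a [MOD 7]) : (t.choose i : F) = a :=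
    (cast_choose_eq_of_mod 7 2 (m := 49) (by norm_num) h23 hi).trans
      (CharP.natCast_eq_natCast' F 7 ha)
  rw [hC 5 0 (by norm_num) (by simp [Nat.choose, Nat.ModEq]),
    hC 6 0 (by norm_num) (by simp [Nat.choose, Nat.ModEq]),
    hC 7 3 (by norm_num) (by simp [Nat.choose, Nat.ModEq]),
    hC 8 6 (by norm_num) (by simp [Nat.choose, Nat.ModEq]),
    hC 9 3 (by norm_num) (by simp [Nat.choose, Nat.ModEq])] at key
  push_cast at key
  have key2 : T ^ 7 * (T ^ 2 - 5 * N) = 0 := by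
    linear_combination 5 * key - (45 * T ^ 5 * N ^ 2 + 35 * T ^ 7 * N + 2 * T ^ 9) * h7
  exact sub_eq_zero.1 ((mul_eq_zero.1 key2).resolve_left (pow_ne_zero 7 hT))

/-- The k = 4 relation factors as 7(T² - 5N)(2T² - 5N) = 0. On the second branch the k = 9 relation,
available only for q ≥ 20, reduces to 85·T(N/2)⁴ = 0; hence the exceptions q = 13 and p = 17. -/
theorem sq_eq_or_of_mod_three (p : ℕ) [Fact p.Prime] [CharP F p] {n : ℕ} (hqn : q = p ^ n)
    (hq : Fintype.card F = q) (h5 : q % 5 = 3) (hq3 : q ≠ 3) (hN : N ≠ 0)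
    (hg : Function.Injective (oddQuintic T N)) :
    T ^ 2 = 5 * N ∨ ((q = 13 ∨ p = 17) ∧ 2 * T ^ 2 = 5 * N) := by
  have hp : p.Prime := Fact.out
  rcases eq_or_ne p 2 with rfl | hp2
  · exact Or.inl (sq_eq_of_mod_three_of_char_two hqn hq h5 hN hg)
  rcases eq_or_ne p 3 with rfl | hp3
  · exact Or.inl (sq_eq_of_mod_three_of_char_three hqn hq h5 hq3 hN hg)
  rcases eq_or_ne p 7 with rfl | hp7
  · exact Or.inl (sq_eq_of_mod_three_of_char_seven hqn hq h5 hN hg)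
  have hp5 : p ≠ 5 := by
    rintro rfl
    have : n ≠ 0 := by rintro rfl; simp [hqn] at h5
    have : 5 ∣ q := hqn ▸ dvd_pow_self 5 this
    omega
  have hp11 : 11 ≤ p := by
    have := hp.two_le
    by_contra h
    interval_cases p <;> first | omega | norm_num at hp
  have hodd : q % 2 = 1 := by
    rw [hqn]
    exact Nat.odd_iff.1 (Odd.pow (hp.odd_of_ne_two hp2))
  clear hqn
  have hr (r : ℕ) (h0 : 0 < r) (h : r < 11) : (r : F) ≠ 0 :=
    cast_ne_zero_of_lt (F := F) p h0 (by omega)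
  have r2 := hr 2 (by norm_num) (by norm_num)
  have r3 := hr 3 (by norm_num) (by norm_num)
  have r4 := hr 4 (by norm_num) (by norm_num)
  have r5 := hr 5 (by norm_num) (by norm_num)
  have r6 := hr 6 (by norm_num) (by norm_num)
  have r7 := hr 7 (by norm_num) (by norm_num)
  have r8 := hr 8 (by norm_num) (by norm_num)
  have r9 := hr 9 (by norm_num) (by norm_num)
  push_cast at r2 r3 r4 r5 r6 r7 r8 r9
  obtain ⟨t, ht⟩ : ∃ t, 5 * t = q + 7 := ⟨(q + 7) / 5, by omega⟩
  have h5t := five_mul_cast hq ht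
  have key := hermite_coeff_four hg hq ht (by omega)
  have c0 : (1 : F) * (t.choose 0 : F) = 1 := by simp
  have c1 := cast_choose_succ_eq (r := 1) (d' := 5) (b := 7) h5t c0 (by norm_num) (by norm_num)
    one_ne_zero
  have c2 := cast_choose_succ_eq (r := 2) (d' := 25) (b := 7) h5t c1 (by norm_num) (by norm_num) r2
  have c3 := cast_choose_succ_eq (r := 3) (d' := 125) (b := -7) h5t c2 (by norm_num) (by norm_num)
    r3
  have c4 := cast_choose_succ_eq (r := 4) (d' := 625) (b := 14) h5t c3 (by norm_num) (by norm_num)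
    r4
  norm_num at c1 c2 c3 c4
  have key2 : 7 * ((T ^ 2 - 5 * N) * (2 * T ^ 2 - 5 * N)) = 0 := by
    linear_combination 625 * key - 25 * N ^ 2 * c2 - 15 * T ^ 2 * N * c3 - T ^ 4 * c4
  rcases mul_eq_zero.1 ((mul_eq_zero.1 key2).resolve_left r7) with h | h
  · exact Or.inl (sub_eq_zero.1 h)
  refine Or.inr ⟨?_, sub_eq_zero.1 h⟩
  by_contra! hcon
  clear h5t key c0 c1 c2 c3 c4 key2
  obtain ⟨t, ht⟩ : ∃ t, 5 * t = q + 17 := ⟨(q + 17) / 5, by omega⟩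
  have h5t := five_mul_cast hq ht
  have hq20 : 20 ≤ q := by
    have := hcon.1
    have : q ≠ 8 := by omega
    have : q ≠ 18 := by omega
    omega
  have key := hermite_coeff_nine hg hq ht hq20
  have c0 : (1 : F) * (t.choose 0 : F) = 1 := by simp
  have c1 := cast_choose_succ_eq (r := 1) (d' := 5) (b := 17) h5t c0 (by norm_num) (by norm_num)
    one_ne_zero
  have c2 := cast_choose_succ_eq (r := 2) (d' := 25) (b := 102) h5t c1 (by norm_num) (by norm_num)
    r2
  have c3 := cast_choose_succ_eq (r := 3) (d' := 125) (b := 238) h5t c2 (by norm_num) (by norm_num)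
    r3
  have c4 := cast_choose_succ_eq (r := 4) (d' := 625) (b := 119) h5t c3 (by norm_num) (by norm_num)
    r4
  have c5 := cast_choose_succ_eq (r := 1) (d' := 5 ^ 6) (b := -357) h5t c4 (by norm_num)
    (by norm_num) one_ne_zero
  have c6 := cast_choose_succ_eq (r := 6) (d' := 5 ^ 7) (b := 476) h5t c5 (by norm_num)
    (by norm_num) r6
  have c7 := cast_choose_succ_eq (r := 7) (d' := 5 ^ 8) (b := -884) h5t c6 (by norm_num)
    (by norm_num) r7
  have c8 := cast_choose_succ_eq (r := 8) (d' := 5 ^ 9) (b := 1989) h5t c7 (by norm_num)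
    (by norm_num) r8
  have c9 := cast_choose_succ_eq (r := 9) (d' := 5 ^ 10) (b := -5083) h5t c8 (by norm_num)
    (by norm_num) r9
  norm_num at c5 c6 c7 c8 c9
  -- With N = 2M the branch reads T² = 5M, so every term of the relation becomes a multiple of TM⁴.
  obtain ⟨M, rfl⟩ : ∃ M, N = 2 * M := ⟨N / 2, by field_simp⟩
  have hT : T ^ 2 = 5 * M := by
    apply mul_left_cancel₀ r2
    linear_combination h
  have key2 : 85 * (T * M ^ 4) = 0 := by
    have e : t.choose 5 * 5 * T * (2 * M) ^ 4 + t.choose 6 * 20 * T ^ 3 * (2 * M) ^ 3 +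
        t.choose 7 * 21 * T ^ 5 * (2 * M) ^ 2 + t.choose 8 * 8 * T ^ 7 * (2 * M) +
        t.choose 9 * T ^ 9 = T * M ^ 4 * (80 * t.choose 5 + 800 * t.choose 6 + 2100 * t.choose 7 +
          2000 * t.choose 8 + 625 * t.choose 9) := by
      rw [show T ^ 3 = T * T ^ 2 by ring, show T ^ 5 = T * (T ^ 2) ^ 2 by ring,
        show T ^ 7 = T * (T ^ 2) ^ 3 by ring, show T ^ 9 = T * (T ^ 2) ^ 4 by ring, hT]
      ring
    rw [e] at key
    linear_combination 15625 * key - T * M ^ 4 * (80 * c5 + 160 * c6 + 84 * c7 + 16 * c8 + c9)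
  have hT0 : T ≠ 0 := by
    rintro rfl
    apply hN
    have : M = 0 := by simpa [r5] using hT.symm
    simp [this]
  have hM0 : M ≠ 0 := by
    rintro rfl
    simp at hN
  have h85 := (mul_eq_zero.1 key2).resolve_right (mul_ne_zero hT0 (pow_ne_zero 4 hM0))
  have h17 : (17 : F) = 0 := by
    have : (5 : F) * 17 = 0 := by linear_combination h85
    exact (mul_eq_zero.1 this).resolve_left r5
  have : p ∣ 17 := (CharP.cast_eq_zero_iff F p 17).1 (by exact_mod_cast h17)
  exact hcon.2 ((Nat.prime_dvd_prime_iff_eq hp (by norm_num)).1 this)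

end Necessity

/-! ### Necessity in characteristic 5 -/

section CharFive

open Polynomial

/-- Weighting by d^(2h-2i) and summing over the field extracts the exponents divisible by q - 1 =
2h, which are those of the coefficients i and i + h. The constant -1 contributes nothing, as 0 < 2h
- 2i < 2h. -/
theorem sum_coeff_add_eq_zero {F : Type*} [Field F] [Fintype F] {P : F[X]} {h i : ℕ}
    (hcard : Fintype.card F = 2 * h + 1) (hdeg : P.natDegree ≤ 2 * h)
    (hP : ∀ d : F, d ≠ 0 → P.eval (d ^ 2) = -1) (hi : 0 < i) (hih : i < h) :
    P.coeff i + P.coeff (i + h) = 0 := by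
  have h1 : ∑ d : F, d ^ (2 * h - 2 * i) * (P.eval (d ^ 2) + 1) = 0 := by
    refine Finset.sum_eq_zero fun d _ => ?_
    rcases eq_or_ne d 0 with rfl | hd
    · rw [zero_pow (by omega), zero_mul]
    · rw [hP d hd]; ring
  simp_rw [mul_add, mul_one, Finset.sum_add_distrib,
    eval_eq_sum_range' (Nat.lt_succ_of_le hdeg), Finset.mul_sum] at h1
  rw [Finset.sum_comm, sum_pow_eq_ite (by omega), if_neg, add_zero] at h1
  · have h2 : ∀ j ∈ Finset.range (2 * h + 1),
        ∑ d : F, d ^ (2 * h - 2 * i) * (P.coeff j * (d ^ 2) ^ j) =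
        (if j = i then -P.coeff j else 0) + (if j = i + h then -P.coeff j else 0) := by
      intro j hj
      rw [Finset.mem_range] at hj
      have : ∑ d : F, d ^ (2 * h - 2 * i) * (P.coeff j * (d ^ 2) ^ j) =
          P.coeff j * ∑ d : F, d ^ (2 * h - 2 * i + 2 * j) := by
        rw [Finset.mul_sum]
        refine Finset.sum_congr rfl fun d _ => ?_
        rw [pow_add, ← pow_mul]
        ring
      rw [this, sum_pow_eq_ite (by omega), hcard, Nat.add_sub_cancel]
      have hdvd : 2 * h ∣ 2 * h - 2 * i + 2 * j ↔ j = i ∨ j = i + h := by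
        constructor
        · rintro ⟨c, hc⟩
          rcases c with _ | _ | _ | c
          · omega
          · omega
          · omega
          · have : 2 * h * (c + 1 + 1 + 1) = 2 * h * c + 6 * h := by ring
            omega
        · rintro (rfl | rfl)
          · exact ⟨1, by omega⟩
          · exact ⟨2, by omega⟩
      simp only [hdvd]
      by_cases e1 : j = i
      · rw [if_pos (Or.inl e1), if_pos e1, if_neg (by omega)]
        ring
      · by_cases e2 : j = i + h
        · rw [if_pos (Or.inr e2), if_neg e1, if_pos e2]
          ring
        · rw [if_neg (by tauto), if_neg e1, if_neg e2]
          ring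
    rw [Finset.sum_congr rfl h2, Finset.sum_add_distrib, Finset.sum_ite_eq', Finset.sum_ite_eq',
      if_pos (by rw [Finset.mem_range]; omega), if_pos (by rw [Finset.mem_range]; omega)] at h1
    linear_combination -h1
  · rw [hcard, Nat.add_sub_cancel]
    intro hd
    have := Nat.le_of_dvd (by omega) hd
    omega

/-- For S = X² - TX + N, the power P of a multiple of S satisfies S·P' = h·S'·P; this is the
coefficient of X^(k+2). -/
theorem coeff_quadratic_pow {F : Type*} [Field F] (T N a : F) {h : ℕ} (hh : 0 < h) (k : ℕ) :
    letI P := (C a * (X ^ 2 - C T * X + C N)) ^ h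
    (k + 1) * P.coeff (k + 1) - T * ((k + 2) * P.coeff (k + 2)) + N * ((k + 3) * P.coeff (k + 3)) =
      2 * h * P.coeff (k + 1) - h * T * P.coeff (k + 2) := by
  set P := (C a * (X ^ 2 - C T * X + C N)) ^ h with hPdef
  have hder : (X ^ 2 - C T * X + C N) * derivative P = C (h : F) * (C 2 * X - C T) * P := by
    obtain ⟨m, rfl⟩ : ∃ m, h = m + 1 := ⟨h - 1, by omega⟩
    rw [hPdef, derivative_pow]
    simp only [derivative_mul, derivative_C, derivative_add, derivative_sub, derivative_X_pow,
      derivative_X, Nat.add_sub_cancel]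
    simp only [Nat.cast_ofNat, Nat.add_one_sub_one, pow_one]
    ring
  have hc := congrArg (fun p => coeff p (k + 2)) hder
  have e1 : (X ^ 2 - C T * X + C N) * derivative P =
      derivative P * X ^ 2 - C T * (derivative P * X) + C N * derivative P := by ring
  have e2 : C (h : F) * (C 2 * X - C T) * P = C (2 * h : F) * (P * X) - C (h * T : F) * P := by
    simp only [C_mul]; ring
  simp only [e1, e2, coeff_add, coeff_sub, coeff_C_mul, coeff_mul_X_pow, coeff_mul_X,
    coeff_derivative] at hc
  push_cast at hc
  linear_combination hc

theorem coeff_quadratic_pow_zero {F : Type*} [Field F] (T N a : F) {h : ℕ} (hh : 0 < h) :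
    letI P := (C a * (X ^ 2 - C T * X + C N)) ^ h
    N * P.coeff 1 = - (h * T * P.coeff 0) := by
  set P := (C a * (X ^ 2 - C T * X + C N)) ^ h with hPdef
  have hder : (X ^ 2 - C T * X + C N) * derivative P = C (h : F) * (C 2 * X - C T) * P := by
    obtain ⟨m, rfl⟩ : ∃ m, h = m + 1 := ⟨h - 1, by omega⟩
    rw [hPdef, derivative_pow]
    simp only [derivative_mul, derivative_C, derivative_add, derivative_sub, derivative_X_pow,
      derivative_X, Nat.add_sub_cancel]
    simp only [Nat.cast_ofNat, Nat.add_one_sub_one, pow_one]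
    ring
  have hc := congrArg (fun p => coeff p 0) hder
  simp [mul_coeff_zero, coeff_derivative] at hc
  linear_combination hc

/-- Since 3 = 1/2 in characteristic 5, s and d are the sum and difference of the two arguments. -/
theorem sub_eq_of_char_five {F : Type*} [Field F] [CharP F 5] (T N s d : F) :
    oddQuintic T N (3 * (s + d)) - oddQuintic T N (3 * (s - d)) =
      d * (d ^ 4 - T * d ^ 2 + 2 * T * s ^ 2 + N) := by
  have h5 : (5 : F) = 0 := by exact_mod_cast CharP.cast_eq_zero F 5
  rw [oddQuintic, oddQuintic]
  linear_combination (97 * d ^ 5 + 486 * s ^ 4 * d + 972 * s ^ 2 * d ^ 3 + 11 * T * d ^ 3 +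
    32 * T * s ^ 2 * d + N * d) * h5

theorem sq_eq_of_char_five {F : Type*} [Field F] [Fintype F] [CharP F 5] {T N : F} {q : ℕ}
    (hq : Fintype.card F = q) (h25 : 25 ≤ q) (hodd : q % 2 = 1) (hT : T ≠ 0) (hN : N ≠ 0)
    (hg : Function.Injective (oddQuintic T N)) : T ^ 2 = 4 * N := by
  have h5 : (5 : F) = 0 := by exact_mod_cast CharP.cast_eq_zero F 5
  have h2 : (2 : F) ≠ 0 := by
    exact_mod_cast cast_ne_zero_of_lt (F := F) 5 (r := 2) (by norm_num) (by norm_num)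
  have hring : ringChar F ≠ 2 := by
    rw [ringChar.eq F 5]; norm_num
  obtain ⟨h, rfl⟩ : ∃ h, q = 2 * h + 1 := ⟨q / 2, by omega⟩
  set P : F[X] := (C (2 * T) * (X ^ 2 - C T * X + C N)) ^ h with hPdef
  have hP : ∀ d : F, d ≠ 0 → P.eval (d ^ 2) = -1 := by
    intro d hd
    -- If it were r², then s = r/T would make the quartic factor vanish, because 2 = -1/2 in
    -- characteristic 5; this gives distinct points with equal values.
    have hns : ¬ IsSquare (2 * T * ((d ^ 2) ^ 2 - T * d ^ 2 + N)) := by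
      rintro ⟨r, hr⟩
      have hz : d ^ 4 - T * d ^ 2 + 2 * T * (r / T) ^ 2 + N = 0 := by
        field_simp
        linear_combination -2 * hr + T * (d ^ 4 - T * d ^ 2 + N) * h5
      have := sub_eq_of_char_five T N (r / T) d
      rw [hz, mul_zero, sub_eq_zero] at this
      have := hg this
      apply hd
      linear_combination this - d * h5
    have hne : 2 * T * ((d ^ 2) ^ 2 - T * d ^ 2 + N) ≠ 0 := by
      intro h0
      rw [h0] at hns
      exact hns (IsSquare.zero)
    have hdi := FiniteField.pow_dichotomy hring hne
    rw [FiniteField.isSquare_iff hring hne] at hns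
    rw [hq, show (2 * h + 1) / 2 = h by omega] at hns hdi
    rw [hPdef]
    simp only [eval_pow, eval_mul, eval_C, eval_add, eval_sub, eval_X]
    tauto
  have hdeg : P.natDegree ≤ 2 * h := by
    rw [hPdef, mul_comm 2 h]
    refine natDegree_pow_le_of_le h ?_
    compute_degree
  have hsum (i : ℕ) (hi : 0 < i) (hih : i < h) : P.coeff i + P.coeff (i + h) = 0 :=
    sum_coeff_add_eq_zero hq hdeg hP hi hih
  have hh : 2 * (h : F) = -1 := by
    have := FiniteField.cast_card_eq_zero F
    rw [hq] at this
    push_cast at this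
    linear_combination this
  have r0 := coeff_quadratic_pow_zero T N (2 * T) (h := h) (by omega)
  have hrec := coeff_quadratic_pow T N (2 * T) (h := h) (by omega)
  simp only [← hPdef] at r0 hrec
  -- The recurrence at h and h + 1, rewritten by P_(i+h) = -P_i, has different scalars from the one
  -- at 0 and 1. Together they overdetermine P_1, …, P_4; q ≥ 25 ensures 4 < h.
  have a0 := hrec 0
  have a1 := hrec 1
  have b0 := hrec h
  have b1 := hrec (h + 1)
  have s1 := hsum 1 (by omega) (by omega)
  have s2 := hsum 2 (by omega) (by omega)
  have s3 := hsum 3 (by omega) (by omega)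
  have s4 := hsum 4 (by omega) (by omega)
  have c0 : P.coeff 0 ≠ 0 := by
    rw [hPdef, coeff_zero_eq_eval_zero]
    simp [hT, hN, h2]
  rw [show 1 + h = h + 1 by ring] at s1
  rw [show 2 + h = h + 2 by ring] at s2
  rw [show 3 + h = h + 3 by ring] at s3
  rw [show 4 + h = h + 4 by ring] at s4
  rw [show h + 1 + 1 = h + 2 by ring, show h + 1 + 2 = h + 3 by ring,
    show h + 1 + 3 = h + 4 by ring] at b1
  norm_num at a0 a1 b0 b1
  rw [eq_neg_of_add_eq_zero_right s1, eq_neg_of_add_eq_zero_right s2,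
    eq_neg_of_add_eq_zero_right s3] at b0
  rw [eq_neg_of_add_eq_zero_right s2, eq_neg_of_add_eq_zero_right s3,
    eq_neg_of_add_eq_zero_right s4] at b1
  have hh' : (h : F) = 2 := by
    apply mul_left_cancel₀ h2
    linear_combination hh - h5
  rw [hh'] at a0 a1 b0 b1 r0
  generalize P.coeff 0 = p0 at *
  generalize P.coeff 1 = p1 at *
  generalize P.coeff 2 = p2 at *
  generalize P.coeff 3 = p3 at *
  generalize P.coeff 4 = p4 at *
  have e1 : p1 = N * p3 := by linear_combination 3 * a0 + (2 * p1 - 2 * N * p3) * h5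
  have e2 : p1 = -(2 * T * p2) := by linear_combination b0 + N * p3 * h5
  have e3 : p2 = 3 * T * p3 := by
    linear_combination 2 * a1 + 8 * b1 + (p2 - 5 * T * p3 + 8 * N * p4) * h5
  have hp3 : p3 ≠ 0 := by
    rintro rfl
    rw [mul_zero] at e1
    rw [e1, mul_zero] at r0
    have : 2 * T * p0 = 0 := by linear_combination r0
    simp [h2, hT, c0] at this
  apply mul_right_cancel₀ hp3
  linear_combination -4 * (e2 - e1 - 2 * T * e3) + 5 * T ^ 2 * p3 * h5

end CharFive

/-! ### Roots of c² - 3c + 1, and sufficiency criteria -/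

theorem golden_pow_ne_self_of_isAlgClosed {M : Type*} [Field M] [IsAlgClosed M] (p : ℕ)
    [Fact p.Prime] [CharP M p] {q n : ℕ} (hqn : q = p ^ n) (h5 : q % 5 = 2 ∨ q % 5 = 3) {c : M}
    (hc : c ^ 2 - 3 * c + 1 = 0) : c ^ q ≠ c := by
  intro hcq
  have h5M : (5 : M) ≠ 0 := by
    intro h
    have : p ∣ 5 := (CharP.cast_eq_zero_iff M p 5).1 (by exact_mod_cast h)
    have hp5 : p = 5 := (Nat.prime_dvd_prime_iff_eq Fact.out (by norm_num)).1 this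
    have : n ≠ 0 := by rintro rfl; simp [hqn] at h5
    have : 5 ∣ q := by rw [hqn, hp5]; exact dvd_pow_self 5 this
    omega
  -- Writing 1 - c = z + 1/z turns c² - 3c + 1 = 0 into z⁴ + z³ + z² + z + 1 = 0. If c^q = c, then
  -- z^q is z or 1/z, whereas q ≡ ±2 mod 5 makes it z² or z³; so z = 1, and then 5 = 0.
  obtain ⟨z, hz⟩ : ∃ z : M, z ^ 2 - (1 - c) * z + 1 = 0 := by
    have hdeg : (Polynomial.X ^ 2 - Polynomial.C (1 - c) * Polynomial.X + 1 :
        Polynomial M).degree = 2 := by compute_degree!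
    obtain ⟨z, hz⟩ := IsAlgClosed.exists_root _ (by rw [hdeg]; norm_num)
    exact ⟨z, by simpa [Polynomial.IsRoot] using hz⟩
  have hz5 : z ^ 5 = 1 := by
    linear_combination (z - 1) * (z ^ 2 + (2 - c) * z + 1) * hz + (z - 1) * z ^ 2 * hc
  have hzq : (z ^ q) ^ 2 - (1 - c) * z ^ q + 1 = 0 := by
    have := congrArg (iterateFrobenius M p n) hz
    simpa only [map_add, map_sub, map_mul, map_pow, map_one, map_zero, iterateFrobenius_def, ← hqn,
      hcq] using this
  have hz1 : z = 1 := by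
    have h1 : (z ^ q - z) * (z ^ q + z - (1 - c)) = 0 := by linear_combination hzq - hz
    have h2 : z ^ q = z ^ (q % 5) := by
      conv_lhs => rw [← Nat.div_add_mod q 5, pow_add, pow_mul, hz5, one_pow, one_mul]
    have hz0 : z ≠ 0 := by rintro rfl; simp at hz5
    rw [h2] at h1
    rcases h5 with h5 | h5 <;> rw [h5] at h1 <;> rcases mul_eq_zero.1 h1 with h | h
    · apply mul_left_cancel₀ hz0
      linear_combination h
    · have h3 : z ^ 3 = 1 := by linear_combination z * h - hz
      linear_combination (z ^ 3 + 1) * h3 - z * hz5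
    · have h3 : z ^ 2 = 1 := by
        apply mul_left_cancel₀ hz0
        linear_combination h
      linear_combination hz5 - (z ^ 3 + z) * h3
    · have h3 : z ^ 4 = 1 := by linear_combination z * h - hz
      linear_combination hz5 - z * h3
  rw [hz1] at hz
  have hc1 : c = -1 := by linear_combination hz
  rw [hc1] at hc
  exact h5M (by linear_combination hc)

theorem golden_pow_ne_self {L : Type*} [Field L] (p : ℕ) [Fact p.Prime] [CharP L p] {q n : ℕ}
    (hqn : q = p ^ n) (h5 : q % 5 = 2 ∨ q % 5 = 3) {b : L} (hb : b ^ 2 - 3 * b + 1 = 0) :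
    b ^ q ≠ b := by
  intro hbq
  have : CharP (AlgebraicClosure L) p :=
    charP_of_injective_algebraMap (algebraMap L (AlgebraicClosure L)).injective p
  refine golden_pow_ne_self_of_isAlgClosed p hqn h5 (c := algebraMap L (AlgebraicClosure L) b) ?_ ?_
  · have := congrArg (algebraMap L (AlgebraicClosure L)) hb
    simpa only [map_add, map_sub, map_mul, map_pow, map_one, map_zero, map_ofNat] using this
  · rw [← map_pow, hbq]

/-- By `hF` the form a² - 3ab + b² is anisotropic. When T² = 5N, 25 times the quartic (g(x) -
g(y))/(x - y) is this form at (5(x+y)² + T, 5xy - T). Adding the two vanishing entries gives the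
form at (x, -y), so x = y = 0. -/
theorem injective_oddQuintic_of_sq_eq {F : Type*} [Field F] {T N : F}
    (h5 : (5 : F) ≠ 0) (hTN : T ^ 2 = 5 * N) (hF : ∀ b : F, b ^ 2 - 3 * b + 1 ≠ 0) :
    Function.Injective (oddQuintic T N) := by
  have hform : ∀ a b : F, a ^ 2 - 3 * a * b + b ^ 2 = 0 → a = 0 ∧ b = 0 := by
    intro a b h
    have hb : b = 0 := by
      by_contra hb
      apply hF (a / b)
      field_simp
      linear_combination h
    subst hb
    simpa using h
  intro x y hxy
  by_contra hne
  have h1 : (x - y) * ((x + y) ^ 4 - 3 * (x + y) ^ 2 * (x * y) + (x * y) ^ 2 +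
      T * ((x + y) ^ 2 - x * y) + N) = 0 := by
    rw [oddQuintic, oddQuintic] at hxy
    linear_combination hxy
  have h2 := (mul_eq_zero.1 h1).resolve_left (sub_ne_zero.2 hne)
  obtain ⟨ha, hb⟩ := hform (5 * (x + y) ^ 2 + T) (5 * (x * y) - T) (by
    linear_combination 25 * h2 + 5 * hTN)
  obtain ⟨hx, hy⟩ := hform x (-y) (by
    apply mul_left_cancel₀ h5
    linear_combination ha + hb)
  exact hne (by rw [hx, neg_eq_zero.1 hy])

theorem injective_oddQuintic_of_char_five {F : Type*} [Field F] [CharP F 5] {T N : F}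
    (h : ∀ s d : F, d ≠ 0 → d ^ 4 - T * d ^ 2 + 2 * T * s ^ 2 + N ≠ 0) :
    Function.Injective (oddQuintic T N) := by
  intro x y hxy
  by_contra hne
  have h5 : (5 : F) = 0 := by exact_mod_cast CharP.cast_eq_zero F 5
  have := sub_eq_of_char_five T N (x + y) (x - y)
  rw [show 3 * (x + y + (x - y)) = x by linear_combination x * h5,
    show 3 * (x + y - (x - y)) = y by linear_combination y * h5, hxy, sub_self] at this
  exact (mul_ne_zero (sub_ne_zero.2 hne) (h _ _ (sub_ne_zero.2 hne))) this.symm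

theorem injective_oddQuintic_map {F G : Type*} [Field F] [Field G] (e : G ≃+* F) (T N : G) :
    Function.Injective (oddQuintic (e T) (e N)) ↔ Function.Injective (oddQuintic T N) := by
  have h : oddQuintic (e T) (e N) ∘ e = e ∘ oddQuintic T N := by
    ext y
    simp [oddQuintic]
  rw [← Function.Injective.of_comp_iff' _ e.bijective, h,
    Function.Injective.of_comp_iff e.injective]

/-! ### The fields with 13, 5 and 3 elements -/

theorem nonempty_zmod_ringEquiv {F : Type*} [Field F] [Fintype F] {p : ℕ} [hp : Fact p.Prime]
    (h : Fintype.card F = p) : Nonempty (ZMod p ≃+* F) :=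
  ⟨ZMod.ringEquivOfPrime F hp.out h⟩

instance : Fact (Nat.Prime 13) := ⟨by norm_num⟩

/-- Modulo 13 the branch 2T² = 5N reads N = 3T². -/
theorem injective_oddQuintic_zmod_thirteen : ∀ T : ZMod 13, T ≠ 0 →
    ((∀ x y : ZMod 13, x ^ 5 + T * x ^ 3 + 3 * T ^ 2 * x = y ^ 5 + T * y ^ 3 + 3 * T ^ 2 * y →
      x = y) ↔ T ^ 6 = -1) := by
  decide +kernel

theorem injective_oddQuintic_zmod_five : ∀ T N : ZMod 5,
    ((∀ x y : ZMod 5, x ^ 5 + T * x ^ 3 + N * x = y ^ 5 + T * y ^ 3 + N * y →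
      x = y) ↔ (T = 0 ∧ N ≠ -1 ∨ T ≠ 0 ∧ N = -1)) := by
  decide +kernel

theorem injective_oddQuintic_iff_of_card_thirteen {F : Type*} [Field F] [Fintype F]
    (hF : Fintype.card F = 13) {T N : F} (hT : T ≠ 0) (hTN : 2 * T ^ 2 = 5 * N) :
    Function.Injective (oddQuintic T N) ↔ T ^ 6 = -1 := by
  obtain ⟨e⟩ := nonempty_zmod_ringEquiv hF
  obtain ⟨T, rfl⟩ := e.surjective T
  obtain ⟨N, rfl⟩ := e.surjective N
  have h : N = 3 * T ^ 2 := by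
    apply e.injective
    have : (13 : F) = 0 := by
      have h := congrArg e (show (13 : ZMod 13) = 0 by decide)
      rwa [map_ofNat, map_zero] at h
    simp only [map_mul, map_pow, map_ofNat]
    linear_combination -8 * hTN + (e T ^ 2 - 3 * e N) * this
  rw [injective_oddQuintic_map, ← map_pow, ← map_one e, ← map_neg, e.injective.eq_iff,
    ← injective_oddQuintic_zmod_thirteen T (by rintro rfl; simp at hT), h]
  rfl

theorem injective_oddQuintic_iff_of_card_five {F : Type*} [Field F] [Fintype F]
    (hF : Fintype.card F = 5) (T N : F) :
    Function.Injective (oddQuintic T N) ↔ (T = 0 ∧ N ≠ -1 ∨ T ≠ 0 ∧ N = -1) := by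
  have : Fact (Nat.Prime 5) := ⟨by norm_num⟩
  obtain ⟨e⟩ := nonempty_zmod_ringEquiv hF
  obtain ⟨T, rfl⟩ := e.surjective T
  obtain ⟨N, rfl⟩ := e.surjective N
  rw [injective_oddQuintic_map, ← map_one e, ← map_neg, Ne, Ne, e.injective.eq_iff,
    map_eq_zero_iff e e.injective]
  exact injective_oddQuintic_zmod_five T N

/-- Under this hypothesis g is linear, g(y) = (1 + T + N)y. It serves both F_3 and F_2. -/
theorem injective_oddQuintic_iff_of_pow_three {F : Type*} [Field F] (hF : ∀ y : F, y ^ 3 = y)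
    (T N : F) : Function.Injective (oddQuintic T N) ↔ 1 + T + N ≠ 0 := by
  have h (y : F) : oddQuintic T N y = (1 + T + N) * y := by
    rw [oddQuintic]
    linear_combination (y ^ 2 + 1 + T) * hF y
  constructor
  · intro hg h0
    exact zero_ne_one (hg (by rw [h, h, h0]; ring) : (0 : F) = 1)
  · intro h0 x y hxy
    rw [h, h] at hxy
    exact mul_left_cancel₀ h0 hxy

/-! ### Counting the admissible α -/

section Counting

open Polynomial

/-- X^q - X splits over K with simple roots, and so does every divisor. -/
theorem ncard_eval_eq_zero {K : Type*} [Field K] [Fintype K] {R : K[X]} {q : ℕ}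
    (hq : Fintype.card K = q) (hR : R ∣ X ^ q - X) :
    {x : K | R.eval x = 0}.ncard = R.natDegree := by
  classical
  subst hq
  have hne : (X ^ Fintype.card K - X : K[X]) ≠ 0 :=
    FiniteField.X_pow_card_sub_X_ne_zero K Fintype.one_lt_card
  have hR0 : R ≠ 0 := ne_zero_of_dvd_ne_zero hne hR
  have hroots := FiniteField.roots_X_pow_card_sub_X K
  have hsplit : (X ^ Fintype.card K - X : K[X]).Splits := by
    rw [splits_iff_card_roots, hroots, FiniteField.X_pow_card_sub_X_natDegree_eq K
      Fintype.one_lt_card]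
    rfl
  have hRs : R.Splits := hsplit.of_dvd hne hR
  have hnodup : R.roots.Nodup := by
    refine Multiset.nodup_of_le (roots.le_of_dvd hne hR) ?_
    rw [hroots]
    exact Finset.univ.nodup
  have : {x : K | R.eval x = 0} = (R.roots.toFinset : Set K) := by
    ext x
    simp [hR0]
  rw [this, Set.ncard_coe_finset, Multiset.toFinset_card_of_nodup hnodup]
  exact (splits_iff_card_roots.1 hRs)

theorem ncard_eval_eq_zero_of_dvd {K : Type*} [Field K] [Fintype K] {R : K[X]} {q : ℕ}
    (hq : Fintype.card K = q) (hR : R ∣ X ^ (q - 1) - 1) :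
    {x : K | R.eval x = 0}.ncard = R.natDegree := by
  refine ncard_eval_eq_zero hq (hR.trans ⟨X, ?_⟩)
  have : 0 < q := hq ▸ Fintype.card_pos
  rw [sub_mul, ← pow_succ, Nat.sub_add_cancel this, one_mul]

theorem X_pow_sub_one_dvd {K : Type*} [Field K] {a b : ℕ} (h : a ∣ b) :
    (X ^ a - 1 : K[X]) ∣ X ^ b - 1 := by
  obtain ⟨c, rfl⟩ := h
  rw [pow_mul]
  simpa using sub_dvd_pow_sub_pow (X ^ a : K[X]) 1 c

theorem sub_one_mul_add_one (Q : ℕ) : (Q - 1) * (Q + 1) = Q ^ 2 - 1 := by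
  rw [mul_comm, ← Nat.sq_sub_sq, one_pow]

theorem ncard_pow_eq_self {K : Type*} [Field K] [Fintype K] {Q : ℕ} (hQ : 1 < Q)
    (hK : Fintype.card K = Q ^ 2) : {x : K | x ^ Q = x}.ncard = Q := by
  have hdvd : (X ^ Q - X : K[X]) ∣ X ^ (Q ^ 2) - X := by
    have h1 : (X ^ Q - X : K[X]) = (X ^ (Q - 1) - 1) * X := by
      rw [sub_mul, ← pow_succ, Nat.sub_add_cancel hQ.le, one_mul]
    have h2 : (X ^ (Q ^ 2) - X : K[X]) = (X ^ (Q ^ 2 - 1) - 1) * X := by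
      rw [sub_mul, ← pow_succ, Nat.sub_add_cancel (Nat.one_le_pow 2 Q (by omega)), one_mul]
    rw [h1, h2]
    exact mul_dvd_mul_right (X_pow_sub_one_dvd ⟨Q + 1, (sub_one_mul_add_one Q).symm⟩) X
  have := ncard_eval_eq_zero hK hdvd
  rw [FiniteField.X_pow_card_sub_X_natDegree_eq K hQ] at this
  simpa [sub_eq_zero] using this

theorem exists_pow_add_one_eq {K : Type*} [Field K] [Fintype K] {Q : ℕ} (hQ : 1 < Q)
    (hK : Fintype.card K = Q ^ 2) {y : K} (hy : y ^ Q = y) : ∃ x : K, x ^ (Q + 1) = y := by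
  rcases eq_or_ne y 0 with rfl | hy0
  · exact ⟨0, by simp⟩
  have hy1 : y ^ (Q - 1) = 1 := by
    apply mul_right_cancel₀ hy0
    rw [← pow_succ, Nat.sub_add_cancel hQ.le, hy, one_mul]
  have hdvd : (X ^ (Q + 1) - C y : K[X]) ∣ X ^ (Q ^ 2 - 1) - 1 := by
    have := sub_dvd_pow_sub_pow (X ^ (Q + 1) : K[X]) (C y) (Q - 1)
    rwa [← C_pow, hy1, C_1, ← pow_mul, mul_comm, sub_one_mul_add_one Q] at this
  have h := ncard_eval_eq_zero_of_dvd hK hdvd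
  rw [natDegree_X_pow_sub_C] at h
  obtain ⟨x, hx⟩ := Set.nonempty_of_ncard_ne_zero (h.trans_ne (by omega))
  exact ⟨x, by simpa [sub_eq_zero] using hx⟩

/-- Frobenius swaps the two roots c and 3 - c, so c^(Q+1) = c(3 - c) = 1 and X² - 3X + 1 divides
X^(Q+1) - 1. Substituting X^(Q-1) for X gives a divisor of X^(Q²-1) - 1. -/
theorem ncard_golden {K : Type*} [Field K] [Fintype K] (p : ℕ) [Fact p.Prime] [CharP K p]
    {Q n : ℕ} (hQ : 1 < Q) (hQn : Q = p ^ n) (hK : Fintype.card K = Q ^ 2)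
    (h5 : Q % 5 = 2 ∨ Q % 5 = 3) :
    {a : K | a ^ (2 * Q - 2) - 3 * a ^ (Q - 1) + 1 = 0}.ncard = 2 * Q - 2 := by
  have hgold : (X ^ 2 - 3 * X + 1 : K[X]) ∣ X ^ (Q + 1) - 1 := by
    rw [← map_dvd_map' (algebraMap K (AlgebraicClosure K))]
    simp only [Polynomial.map_add, Polynomial.map_sub, Polynomial.map_mul, Polynomial.map_pow,
      map_X, Polynomial.map_one, Polynomial.map_ofNat]
    set M := AlgebraicClosure K
    have : CharP M p :=
      charP_of_injective_algebraMap (algebraMap K (AlgebraicClosure K)).injective p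
    have hdeg : (X ^ 2 - 3 * X + 1 : M[X]).degree = 2 := by
      have : (X ^ 2 - 3 * X + 1 : M[X]) = X ^ 2 - C 3 * X + 1 := rfl
      rw [this]
      compute_degree!
    obtain ⟨c, hc⟩ := IsAlgClosed.exists_root _ (by rw [hdeg]; norm_num)
    have hc : c ^ 2 - 3 * c + 1 = 0 := by simpa [Polynomial.IsRoot] using hc
    have hcQ := golden_pow_ne_self p hQn h5 hc
    have hcq : (c ^ Q) ^ 2 - 3 * c ^ Q + 1 = 0 := by
      have := congrArg (iterateFrobenius M p n) hc
      simpa only [map_add, map_sub, map_mul, map_pow, map_one, map_zero, map_ofNat,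
        iterateFrobenius_def, ← hQn] using this
    have hsum : c ^ Q = 3 - c := by
      have : (c ^ Q - c) * (c ^ Q - (3 - c)) = 0 := by linear_combination hcq - hc
      exact sub_eq_zero.1 ((mul_eq_zero.1 this).resolve_left (sub_ne_zero.2 hcQ))
    have hne : c ≠ 3 - c := fun h => hcQ (hsum.trans h.symm)
    have h1 : c ^ (Q + 1) = 1 := by
      rw [pow_succ, hsum]
      linear_combination -hc
    have h2 : (3 - c) ^ (Q + 1) = 1 := by
      rw [← hsum, ← pow_mul, mul_comm, pow_mul, h1, one_pow]
    have hfac : (X ^ 2 - 3 * X + 1 : M[X]) = (X - C c) * (X - C (3 - c)) := by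
      have hC := congrArg C hc
      simp only [C_add, C_sub, C_mul, C_pow, C_1, C_0, C_ofNat] at hC ⊢
      linear_combination hC
    rw [hfac]
    refine IsCoprime.mul_dvd (isCoprime_X_sub_C_of_isUnit_sub (sub_ne_zero.2 hne).isUnit) ?_ ?_
    · rw [dvd_iff_isRoot]
      simp [h1]
    · rw [dvd_iff_isRoot]
      simp [h2]
  have hcomp := map_dvd (expand K (Q - 1)) hgold
  simp only [map_add, map_sub, map_mul, map_pow, map_one, map_ofNat, expand_X, ← pow_mul] at hcomp
  rw [sub_one_mul_add_one Q, show (Q - 1) * 2 = 2 * Q - 2 by omega] at hcomp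
  have h := ncard_eval_eq_zero_of_dvd hK hcomp
  have hd : (X ^ (2 * Q - 2) - 3 * X ^ (Q - 1) + 1 : K[X]).natDegree = 2 * Q - 2 := by
    have : (X ^ (2 * Q - 2) - 3 * X ^ (Q - 1) + 1 : K[X]) =
        X ^ (2 * Q - 2) - C 3 * X ^ (Q - 1) + 1 := rfl
    rw [this]
    compute_degree!
    · simp [show ¬ (2 * Q - 2 = Q - 1) by omega, show ¬ (2 * Q - 2 = 0) by omega]
    all_goals omega
  rw [hd] at h
  simpa using h

theorem ncard_pow_eq_neg_one {K : Type*} [Field K] [Fintype K] {Q : ℕ} (hQ : 1 < Q)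
    (hodd : Q % 2 = 1) (hK : Fintype.card K = Q ^ 2) :
    {a : K | a ^ (Q - 1) = -1 ∨ a ^ ((Q - 1) / 2) = -1}.ncard = 3 * (Q - 1) / 2 := by
  obtain ⟨h, rfl⟩ : ∃ h, Q = 2 * h + 1 := ⟨Q / 2, by omega⟩
  simp only [show 2 * h + 1 - 1 = h * 2 by omega, show h * 2 / 2 = h by omega,
    show 3 * (h * 2) / 2 = 3 * h by omega]
  have hdvd : ((X ^ (h * 2) + 1) * (X ^ h + 1) : K[X]) ∣ X ^ ((2 * h + 1) ^ 2 - 1) - 1 := by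
    have h1 : (X ^ (h * 4) - 1 : K[X]) ∣ X ^ ((2 * h + 1) ^ 2 - 1) - 1 := by
      refine X_pow_sub_one_dvd ⟨h + 1, ?_⟩
      have : (2 * h + 1) ^ 2 = h * 4 * (h + 1) + 1 := by ring
      omega
    refine Dvd.dvd.trans ⟨X ^ h - 1, ?_⟩ h1
    rw [pow_mul, pow_mul]
    ring
  have := ncard_eval_eq_zero_of_dvd hK hdvd
  have hd : ((X ^ (h * 2) + 1) * (X ^ h + 1) : K[X]).natDegree = 3 * h := by
    have e1 : (X ^ (h * 2) + 1 : K[X]).Monic := monic_X_pow_add_C 1 (by omega)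
    have e2 : (X ^ h + 1 : K[X]).Monic := monic_X_pow_add_C 1 (by omega)
    rw [e1.natDegree_mul e2]
    have e3 : (X ^ (h * 2) + 1 : K[X]).natDegree = h * 2 := natDegree_X_pow_add_C
    have e4 : (X ^ h + 1 : K[X]).natDegree = h := natDegree_X_pow_add_C
    rw [e3, e4]
    ring
  rw [hd] at this
  rw [← this]
  congr 1
  ext a
  simp [eq_neg_iff_add_eq_zero]

theorem ncard_of_card_thirteen_sq {K : Type*} [Field K] [Fintype K]
    (hK : Fintype.card K = 13 ^ 2) : {a : K | a ^ 12 - 3 * a ^ 6 + 1 = 0}.ncard = 12 := by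
  have h13 : (13 : K[X]) = 0 := by
    have h := FiniteField.cast_card_eq_zero K
    rw [hK] at h
    push_cast at h
    have : (13 : K) = 0 := by
      have h2 : (13 : K) ^ 2 = 0 := by linear_combination h
      exact (pow_eq_zero_iff two_ne_zero).1 h2
    rw [← C_ofNat, this, C_0]
  have h1 : (X ^ 12 - 3 * X ^ 6 + 1 : K[X]) ∣ X ^ (13 ^ 2 - 1) - 1 := by
    refine Dvd.dvd.trans (b := X ^ 84 - 1) ?_ (X_pow_sub_one_dvd ⟨2, by norm_num⟩)
    -- The coefficients are Fibonacci numbers: c² = 3c - 1 gives c⁷ = 377c - 144, which is -1 modulo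
    -- 13. With c = X⁶, the trinomial divides X⁴² + 1.
    refine ⟨(X ^ 30 + 3 * X ^ 24 + 8 * X ^ 18 + 21 * X ^ 12 + 55 * X ^ 6 + 144) *
      (X ^ 42 - 1), ?_⟩
    linear_combination (29 * X ^ 6 - 11) * (X ^ 42 - 1) * h13
  have h := ncard_eval_eq_zero_of_dvd hK h1
  have hd : (X ^ 12 - 3 * X ^ 6 + 1 : K[X]).natDegree = 12 := by
    have : (X ^ 12 - 3 * X ^ 6 + 1 : K[X]) = X ^ 12 - C 3 * X ^ 6 + 1 := rfl
    rw [this]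
    compute_degree!
  rw [hd] at h
  simpa using h

theorem ncard_of_card_five_sq {K : Type*} [Field K] [Fintype K]
    (hK : Fintype.card K = 5 ^ 2) : {a : K | a ^ 4 - a ^ 2 + 1 = 0}.ncard = 4 := by
  have h1 : (X ^ 4 - X ^ 2 + 1 : K[X]) ∣ X ^ (5 ^ 2 - 1) - 1 := by
    refine Dvd.dvd.trans (b := X ^ 12 - 1) ?_ (X_pow_sub_one_dvd ⟨2, by norm_num⟩)
    exact ⟨(X ^ 2 + 1) * (X ^ 6 - 1), by ring⟩
  have h := ncard_eval_eq_zero_of_dvd hK h1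
  have hd : (X ^ 4 - X ^ 2 + 1 : K[X]).natDegree = 4 := by compute_degree!
  rw [hd] at h
  simpa using h

theorem ncard_of_card_three_sq {K : Type*} [Field K] [Fintype K]
    (hK : Fintype.card K = 3 ^ 2) : {a : K | a = 1 ∨ a ^ 2 = -1}.ncard = 3 := by
  have h1 : ((X - 1) * (X ^ 2 + 1) : K[X]) ∣ X ^ (3 ^ 2 - 1) - 1 :=
    ⟨(X + 1) * (X ^ 4 + 1), by norm_num; ring⟩
  have h := ncard_eval_eq_zero_of_dvd hK h1
  have hd : ((X - 1) * (X ^ 2 + 1) : K[X]).natDegree = 3 := by compute_degree!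
  rw [hd] at h
  rw [← h]
  congr 1
  ext a
  simp [sub_eq_zero, eq_neg_iff_add_eq_zero]

end Counting

/-! ### Reduction to the subfield, and the conditions in terms of α -/

section Reduction

variable {K : Type*} [Field K] {p n Q : ℕ} {F : Subfield K}
  {α : K} {T N : F}

theorem isPermutationPolynomial_iff [Fintype K] [Fact p.Prime] [CharP K p] (hQn : Q = p ^ n) (hQ : 1 < Q) (hK : Fintype.card K = Q ^ 2)
    (hF : ∀ x, x ∈ F ↔ x ^ Q = x) (hT : (T : K) = α + α ^ Q) (hN : (N : K) = α ^ (Q + 1)) :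
    IsPermutationPolynomial
      (Polynomial.X ^ (2 * Q + 3) + Polynomial.C α * Polynomial.X : Polynomial K) ↔
      Function.Injective (oddQuintic T N) := by
  rw [IsPermutationPolynomial, ← Finite.injective_iff_bijective]
  set f : K → K := fun c =>
    Polynomial.eval c (Polynomial.X ^ (2 * Q + 3) + Polynomial.C α * Polynomial.X) with hf
  have hfx (x : K) : f x = x * ((x ^ (Q + 1)) ^ 2 + α) := by
    simp only [hf, Polynomial.eval_add, Polynomial.eval_mul, Polynomial.eval_pow,
      Polynomial.eval_X, Polynomial.eval_C]
    ring
  have hnorm (x : K) : x ^ (Q + 1) ∈ F := by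
    rw [hF, ← pow_mul, show (Q + 1) * Q = Q ^ 2 + Q by ring, pow_add, ← hK,
      FiniteField.pow_card, pow_succ']
  have hg (y : F) : ((oddQuintic T N y : F) : K) = y * ((y : K) ^ 2 + α) * ((y : K) ^ 2 + α ^ Q) := by
    rw [oddQuintic]
    push_cast
    rw [hT, hN]
    ring
  have hfg (x : K) : f x ^ (Q + 1) = (oddQuintic T N ⟨x ^ (Q + 1), hnorm x⟩ : F) := by
    rw [hg, hfx, mul_pow]
    have h1 : ((x ^ (Q + 1)) ^ 2 + α) ^ Q = (x ^ (Q + 1)) ^ 2 + α ^ Q := by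
      have := add_pow_char_pow (p := p) (n := n) ((x ^ (Q + 1)) ^ 2) α
      rw [← hQn] at this
      rw [this, ← pow_mul, mul_comm 2 Q, pow_mul, (hF _).1 (hnorm x)]
    rw [pow_succ (_ + α), h1]
    ring
  have hscale (x z : K) (hz : z ^ (Q + 1) = 1) : f (z * x) = z * f x := by
    rw [hfx, hfx, mul_pow, hz, one_mul]
    ring
  have hf0 : f 0 = 0 := by rw [hfx, zero_mul]
  constructor
  · intro hinj a b hab
    obtain ⟨x, hx⟩ := exists_pow_add_one_eq hQ hK ((hF _).1 a.2)
    obtain ⟨y, hy⟩ := exists_pow_add_one_eq hQ hK ((hF _).1 b.2)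
    have hxa : (⟨x ^ (Q + 1), hnorm x⟩ : F) = a := Subtype.ext hx
    have hyb : (⟨y ^ (Q + 1), hnorm y⟩ : F) = b := Subtype.ext hy
    have h1 : f x ^ (Q + 1) = f y ^ (Q + 1) := by rw [hfg, hfg, hxa, hyb, hab]
    have h2 : x ^ (Q + 1) = y ^ (Q + 1) := by
      rcases eq_or_ne (f y) 0 with h0 | h0
      · have h3 : f x = 0 := by
          rw [h0, zero_pow (Nat.succ_ne_zero Q)] at h1
          exact (pow_eq_zero_iff (Nat.succ_ne_zero Q)).1 h1
        rw [hinj (h3.trans h0.symm)]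
      -- The quotient z of the two values has norm 1, so f(zy) = f(x); injectivity gives x = zy,
      -- hence equal norms.
      · have hz : (f x / f y) ^ (Q + 1) = 1 := by
          rw [div_pow, h1, div_self (pow_ne_zero _ h0)]
        have h3 : f x = f (f x / f y * y) := by
          rw [hscale _ _ hz, div_mul_cancel₀ _ h0]
        have h4 := congrArg (· ^ (Q + 1)) (hinj h3)
        simp only [mul_pow, hz, one_mul] at h4
        exact h4
    rw [← hxa, ← hyb]
    exact Subtype.ext h2
  · intro hinj x y hxy
    have h1 := hinj (Subtype.ext (by rw [← hfg, ← hfg, hxy]) :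
      oddQuintic T N ⟨x ^ (Q + 1), hnorm x⟩ = oddQuintic T N ⟨y ^ (Q + 1), hnorm y⟩)
    have h2 : x ^ (Q + 1) = y ^ (Q + 1) := congrArg Subtype.val h1
    rcases eq_or_ne (f y) 0 with h0 | h0
    · have hzero : ∀ z : K, f z = 0 → z = 0 := by
        intro z hz
        have h3 : oddQuintic T N ⟨z ^ (Q + 1), hnorm z⟩ = oddQuintic T N 0 := by
          apply Subtype.ext
          rw [← hfg, hz, oddQuintic_zero, zero_pow (Nat.succ_ne_zero Q)]
          rfl
        have h4 : z ^ (Q + 1) = 0 := congrArg Subtype.val (hinj h3)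
        exact (pow_eq_zero_iff (Nat.succ_ne_zero Q)).1 h4
      rw [hzero x (hxy.trans h0), hzero y h0]
    · rw [hfx, hfx, h2] at hxy
      rw [hfx] at h0
      exact mul_right_cancel₀ (right_ne_zero_of_mul h0) hxy

theorem sq_eq_five_mul_iff (hQ : 1 < Q) (hα : α ≠ 0) (hT : (T : K) = α + α ^ Q)
    (hN : (N : K) = α ^ (Q + 1)) :
    T ^ 2 = 5 * N ↔ α ^ (2 * Q - 2) - 3 * α ^ (Q - 1) + 1 = 0 := by
  obtain ⟨m, rfl⟩ : ∃ m, Q = m + 1 := ⟨Q - 1, by omega⟩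
  have h1 : T ^ 2 = 5 * N ↔ (α + α ^ (m + 1)) ^ 2 = 5 * α ^ (m + 1 + 1) := by
    rw [← hT, ← hN, Subtype.ext_iff]
    rfl
  have h2 : (α + α ^ (m + 1)) ^ 2 - 5 * α ^ (m + 1 + 1) =
      α ^ 2 * (α ^ (2 * m) - 3 * α ^ m + 1) := by ring
  rw [h1, ← sub_eq_zero, h2, mul_eq_zero, or_iff_right (pow_ne_zero 2 hα),
    show 2 * (m + 1) - 2 = 2 * m by omega, show m + 1 - 1 = m by omega]

theorem pow_sub_one_eq_one (hQ : 1 < Q) (hF : ∀ x, x ∈ F ↔ x ^ Q = x) {x : K} (hx : x ∈ F)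
    (hx0 : x ≠ 0) : x ^ (Q - 1) = 1 := by
  apply mul_right_cancel₀ hx0
  rw [← pow_succ, Nat.sub_add_cancel hQ.le, one_mul, (hF x).1 hx]

theorem pow_sub_one_eq_one_of_pow_four (hQ : 1 < Q) (hF : ∀ x, x ∈ F ↔ x ^ Q = x)
    (hα : α ≠ 0) {d : F} (h : (d : K) ^ 4 = α ^ 2) : α ^ (Q - 1) = 1 := by
  refine pow_sub_one_eq_one hQ hF ?_ hα
  have h1 : ((d : K) ^ 2 - α) * (d ^ 2 + α) = 0 := by linear_combination h
  rcases mul_eq_zero.1 h1 with h2 | h2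
  · rw [← sub_eq_zero.1 h2]
    exact F.pow_mem d.2 2
  · rw [eq_neg_of_add_eq_zero_right h2]
    exact F.neg_mem (F.pow_mem d.2 2)

/-- Only q = 9 with T = 0 remains. There t = 4 in Hermite's criterion gives N² = -1, so N⁴ = 1,
while T = 0 means α⁸ = -1 and N⁴ = α⁴⁰ = -1. -/
theorem not_injective_oddQuintic_of_mod_four [Fact p.Prime] [Fintype F] [CharP F p] (hQn : Q = p ^ n)
    (hFc : Fintype.card F = Q) (h5 : Q % 5 = 4) (hα : α ≠ 0) (hT : (T : K) = α + α ^ Q)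
    (hN : (N : K) = α ^ (Q + 1)) : ¬ Function.Injective (oddQuintic T N) := by
  intro hg
  have hN0 : N ≠ 0 := by
    rintro rfl
    exact pow_ne_zero _ hα hN.symm
  have h9 := card_eq_nine_of_mod_four p hQn hFc h5 hN0 hg
  have hT0 := eq_zero_of_mod_four hFc h5 hg
  subst hT0
  rw [h9] at hFc hT hN
  have key := hermite_oddQuintic hg (t := 4) (by norm_num) (by rw [hFc]; norm_num)
  have h9F : (9 : F) = 0 := by
    have := FiniteField.cast_card_eq_zero F
    rw [hFc] at this
    exact_mod_cast this
  have h3 : (3 : F) = 0 := by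
    have h2 : (3 : F) ^ 2 = 0 := by linear_combination h9F
    exact (pow_eq_zero_iff two_ne_zero).1 h2
  rw [hFc] at key
  norm_num [Finset.sum_range_succ] at key
  have hN2 : N * (N ^ 2 + 1) = 0 := by linear_combination key - (N + N ^ 3) * h3
  have hN2 := (mul_eq_zero.1 hN2).resolve_left hN0
  have h8 : α ^ 8 = -1 := by
    have : α * (α ^ 8 + 1) = 0 := by
      rw [ZeroMemClass.coe_zero] at hT
      linear_combination -hT
    exact eq_neg_of_add_eq_zero_left ((mul_eq_zero.1 this).resolve_left hα)
  have h4 : (N : K) ^ 2 = -1 := by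
    have := congrArg (Subtype.val) (eq_neg_of_add_eq_zero_left hN2)
    simpa using this
  have h4' : (N : K) ^ 4 = -1 := by
    rw [hN, ← pow_mul, show (9 + 1) * 4 = 8 * 5 by norm_num, pow_mul, h8]
    norm_num
  have h3K : (3 : K) = 0 := by
    have := congrArg F.subtype h3
    rwa [map_ofNat, map_zero] at this
  exact one_ne_zero (α := K) (by linear_combination h3K + ((N : K) ^ 2 - 1) * h4 - h4')

theorem not_golden_of_mem [Fact p.Prime] [CharP K p] (hQn : Q = p ^ n) (hF : ∀ x, x ∈ F ↔ x ^ Q = x)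
    (h5 : Q % 5 = 2 ∨ Q % 5 = 3) (b : F) : b ^ 2 - 3 * b + 1 ≠ 0 := by
  intro h
  refine golden_pow_ne_self p hQn h5 (b := (b : K)) ?_ ((hF _).1 b.2)
  have := congrArg Subtype.val h
  push_cast at this
  exact this

theorem injective_of_sq_eq_five_mul [Fact p.Prime] [CharP K p] [CharP F p] (hQn : Q = p ^ n)
    (hF : ∀ x, x ∈ F ↔ x ^ Q = x) (h5 : Q % 5 = 2 ∨ Q % 5 = 3) (hTN : T ^ 2 = 5 * N) :
    Function.Injective (oddQuintic T N) := by
  refine injective_oddQuintic_of_sq_eq ?_ hTN (not_golden_of_mem hQn hF h5)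
  intro h
  have : p ∣ 5 := (CharP.cast_eq_zero_iff F p 5).1 (by exact_mod_cast h)
  have hp5 : p = 5 := (Nat.prime_dvd_prime_iff_eq Fact.out (by norm_num)).1 this
  have : n ≠ 0 := by rintro rfl; simp [hQn] at h5
  have : 5 ∣ Q := by rw [hQn, hp5]; exact dvd_pow_self 5 this
  omega

theorem sq_eq_of_injective_of_mod_two_or_three [Fact p.Prime] [CharP K p] [Fintype F]
    [CharP F p] (hQn : Q = p ^ n)
    (hQ : 1 < Q) (hF : ∀ x, x ∈ F ↔ x ^ Q = x)
    (hFc : Fintype.card F = Q) (h5 : Q % 5 = 2 ∨ Q % 5 = 3) (hQ3 : Q ≠ 3) (hQ13 : Q ≠ 13)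
    (hα : α ≠ 0) (hT : (T : K) = α + α ^ Q) (hN : (N : K) = α ^ (Q + 1))
    (hg : Function.Injective (oddQuintic T N)) : T ^ 2 = 5 * N := by
  have hN0 : N ≠ 0 := by
    rintro rfl
    exact pow_ne_zero _ hα hN.symm
  rcases h5 with h5 | h5
  · rcases eq_or_ne Q 2 with rfl | hQ2
    · have h2 : (2 : F) = 0 := by
        have := FiniteField.cast_card_eq_zero F
        rw [hFc] at this
        exact_mod_cast this
      have hF2 (y : F) : y ^ 2 = y := Subtype.ext (by simpa using (hF _).1 y.2)
      have h3 : ∀ y : F, y ^ 3 = y := fun y => by rw [pow_succ, hF2, ← pow_two, hF2]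
      rw [injective_oddQuintic_iff_of_pow_three h3] at hg
      have h1 : ∀ y : F, y ≠ 0 → y = 1 := fun y hy => by
        apply mul_left_cancel₀ hy
        rw [← pow_two, hF2, mul_one]
      have h4 := h1 _ hN0
      have h5 := h1 _ hg
      rw [h4] at h5 ⊢
      rw [hF2]
      linear_combination h5 - 3 * h2
    · exact sq_eq_of_mod_two p hQn hFc h5 hQ2 hN0 hg
  · rcases sq_eq_or_of_mod_three p hQn hFc h5 hQ3 hN0 hg with h | ⟨h13 | rfl, h⟩
    · exact h
    · exact absurd h13 hQ13
    · exfalso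
      have h17 : (17 : F) = 0 := by exact_mod_cast CharP.cast_eq_zero F 17
      have hr (r : ℕ) (h0 : 0 < r) (h : r < 17) : (r : K) ≠ 0 := cast_ne_zero_of_lt 17 h0 h
      have h17K : (17 : K) = 0 := by exact_mod_cast CharP.cast_eq_zero K 17
      have hNT : N = 14 * T ^ 2 := by linear_combination -7 * h - 2 * N * h17
      have hNTK : (N : K) = 14 * (T : K) ^ 2 := by
        have := congrArg F.subtype hNT
        rw [map_mul, map_ofNat, map_pow] at this
        exact this
      -- With N = 14T² the discriminant T² - 4N is (8T)² modulo 17, so α would lie in F. Then T =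
      -- 2α, which is incompatible with α = 13T or α = 5T.
      have hquad : (α - 13 * T) * (α - 5 * T) = 0 := by
        have h1 : α ^ 2 - T * α + N = 0 := by rw [hT, hN]; ring
        linear_combination h1 - hNTK + (3 * (T : K) ^ 2 - α * T) * h17K
      have h2 : ∀ r : ℕ, α = r * T → α ^ Q = α := fun r h => by
        apply (hF α).1
        rw [h]
        exact F.mul_mem (natCast_mem F r) T.2
      have hfin : ∀ r : ℕ, r ≠ 0 → r < 17 → (r : K) * α ≠ 0 := fun r h0 h1 =>
        mul_ne_zero (hr r (Nat.pos_of_ne_zero h0) h1) hα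
      rcases mul_eq_zero.1 hquad with h | h
      · have h3 := h2 13 (by push_cast; linear_combination h)
        apply hfin 8 (by norm_num) (by norm_num)
        rw [hT, h3] at h
        push_cast
        linear_combination -h - α * h17K
      · have h3 := h2 5 (by push_cast; linear_combination h)
        apply hfin 9 (by norm_num) (by norm_num)
        rw [hT, h3] at h
        push_cast
        linear_combination -h

/-- Here 1 + T + N = (α + 1)⁴, so only α = -1 fails; the alternatives list the factors of (X⁸ -
1)/(X + 1). -/
theorem injective_iff_of_card_three (hF : ∀ x, x ∈ F ↔ x ^ 3 = x)
    (hα9 : α ^ 9 = α) (hα : α ≠ 0) (hT : (T : K) = α + α ^ 3) (hN : (N : K) = α ^ 4)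
    (h3 : (3 : K) = 0) : Function.Injective (oddQuintic T N) ↔
      α ^ 4 - 3 * α ^ 2 + 1 = 0 ∨ α = 1 ∨ α ^ 2 = -1 := by
  have hF3 : ∀ y : F, y ^ 3 = y := fun y => Subtype.ext (by simpa using (hF _).1 y.2)
  rw [injective_oddQuintic_iff_of_pow_three hF3]
  have h1 : 1 + T + N = 0 ↔ α = -1 := by
    have h2 : ((1 + T + N : F) : K) = (α + 1) ^ 4 := by
      push_cast
      rw [hT, hN]
      linear_combination (-α ^ 3 - 2 * α ^ 2 - α) * h3
    rw [← ZeroMemClass.coe_eq_zero, h2, pow_eq_zero_iff (by norm_num), add_eq_zero_iff_eq_neg]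
  have h8 : (α + 1) * ((α ^ 4 + 1) * ((α - 1) * (α ^ 2 + 1))) = 0 := by
    apply mul_left_cancel₀ hα
    linear_combination hα9
  rw [Ne, h1]
  constructor
  · intro h
    have h9 := (mul_eq_zero.1 h8).resolve_left (fun h0 => h (eq_neg_of_add_eq_zero_left h0))
    rcases mul_eq_zero.1 h9 with h | h
    · left
      linear_combination h - α ^ 2 * h3
    rcases mul_eq_zero.1 h with h | h
    · exact Or.inr (Or.inl (sub_eq_zero.1 h))
    · exact Or.inr (Or.inr (eq_neg_of_add_eq_zero_left h))
  · rintro h rfl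
    apply one_ne_zero (α := K)
    rcases h with h | h | h
    · linear_combination -h
    · linear_combination h + h3
    · linear_combination h3 - h

theorem injective_iff_of_card_thirteen [Fintype F] [CharP K 13] [CharP F 13]
    (hF : ∀ x, x ∈ F ↔ x ^ 13 = x) (hFc : Fintype.card F = 13)
    (hα : α ≠ 0) (hT : (T : K) = α + α ^ 13) (hN : (N : K) = α ^ 14) :
    Function.Injective (oddQuintic T N) ↔ T ^ 2 = 5 * N ∨ α ^ 12 - 3 * α ^ 6 + 1 = 0 := by
  have hN0 : N ≠ 0 := by
    rintro rfl
    exact pow_ne_zero _ hα hN.symm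
  have h13 : (13 : K) = 0 := by exact_mod_cast CharP.cast_eq_zero K 13
  have h13F : (13 : F) = 0 := by exact_mod_cast CharP.cast_eq_zero F 13
  have hT0 : 2 * T ^ 2 = 5 * N → T ≠ 0 := by
    rintro h rfl
    apply hN0
    linear_combination -8 * h - 3 * N * h13F
  have hTN : 2 * T ^ 2 = 5 * N ↔ 2 * (T : K) ^ 2 = 5 * N := by
    rw [Subtype.ext_iff]
    rfl
  have hT6 : T ^ 6 = -1 ↔ (T : K) ^ 6 = -1 := by
    rw [Subtype.ext_iff]
    rfl
  constructor
  · intro hg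
    rcases sq_eq_or_of_mod_three 13 (n := 1) rfl hFc rfl (by norm_num) hN0 hg with h | ⟨_, h⟩
    · exact Or.inl h
    · right
      have h6 := hT6.1 ((injective_oddQuintic_iff_of_card_thirteen hFc (hT0 h) h).1 hg)
      have h7 := hTN.1 h
      rw [hT, hN] at h7
      -- Modulo 13, 2T² = 5N becomes T² = 9N, so T = ±3α⁷. The two factors are the two signs; they
      -- give α⁴² = -1 and 1, hence T⁶ = -1 and 1, as 729 ≡ 1.
      have h8 : α ^ 2 * ((α ^ 12 - 3 * α ^ 6 + 1) * (α ^ 12 + 3 * α ^ 6 + 1)) = 0 := by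
        linear_combination 7 * h7 - (α ^ 26 + α ^ 2) * h13
      rcases mul_eq_zero.1 ((mul_eq_zero.1 h8).resolve_left (pow_ne_zero 2 hα)) with h | h
      · exact h
      · exfalso
        have hT7 : (T : K) = -3 * α ^ 7 := by rw [hT]; linear_combination α * h
        have h42 : α ^ 42 = 1 := by
          linear_combination (α ^ 30 - 3 * α ^ 24 + 8 * α ^ 18 - 21 * α ^ 12 + 55 * α ^ 6 - 144) * h
            + (29 * α ^ 6 + 11) * h13
        rw [hT7] at h6
        apply one_ne_zero (α := K)
        linear_combination 7 * h6 - 7 * 729 * h42 - 392 * h13 - h13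
  · rintro (h | h)
    · exact injective_of_sq_eq_five_mul (n := 1) rfl hF (by norm_num) h
    · have hT7 : (T : K) = 3 * α ^ 7 := by rw [hT]; linear_combination α * h
      have h42 : α ^ 42 = -1 := by
        linear_combination (α ^ 30 + 3 * α ^ 24 + 8 * α ^ 18 + 21 * α ^ 12 + 55 * α ^ 6 + 144) * h
          + (29 * α ^ 6 - 11) * h13
      have h2 : 2 * T ^ 2 = 5 * N := hTN.2 (by
        rw [hT7, hN]
        linear_combination α ^ 14 * h13)
      refine (injective_oddQuintic_iff_of_card_thirteen hFc (hT0 h2) h2).2 (hT6.2 ?_)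
      rw [hT7]
      linear_combination 729 * h42 - 56 * h13

end Reduction

/-! ### Characteristic 5 in terms of α -/

section CharFive

variable {K : Type*} [Field K] {n Q : ℕ} {F : Subfield K} {α : K} {T N : F}

theorem not_isSquare_iff_pow_half [Fintype F] [CharP F 5] (hFc : Fintype.card F = Q) {a : F}
    (ha : a ≠ 0) (hodd : Q % 2 = 1) : ¬ IsSquare a ↔ (a : K) ^ ((Q - 1) / 2) = -1 := by
  have hring : ringChar F ≠ 2 := by rw [ringChar.eq F 5]; norm_num
  have h1 := FiniteField.pow_dichotomy hring ha
  have h2 : (-1 : F) ≠ 1 := Ring.neg_one_ne_one_of_char_ne_two hring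
  rw [FiniteField.isSquare_iff hring ha]
  rw [hFc, show Q / 2 = (Q - 1) / 2 by omega] at *
  rw [show ((a : K) ^ ((Q - 1) / 2) = -1) ↔ a ^ ((Q - 1) / 2) = -1 by
    rw [Subtype.ext_iff]; rfl]
  constructor
  · intro h
    exact h1.resolve_left h
  · intro h h3
    exact h2 (h.symm.trans h3)

/-- Here T = 0 and N = -α², so a collision would give d⁴ = α². Then α = ±d² lies in F, contradicting
α^(Q-1) = -1. -/
theorem injective_of_pow_eq_neg_one [CharP K 5] [CharP F 5] (hQ : 1 < Q)
    (hF : ∀ x, x ∈ F ↔ x ^ Q = x) (hα : α ≠ 0) (hT : (T : K) = α + α ^ Q)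
    (hN : (N : K) = α ^ (Q + 1)) (h : α ^ (Q - 1) = -1) :
    Function.Injective (oddQuintic T N) := by
  have h5 : (5 : K) = 0 := by exact_mod_cast CharP.cast_eq_zero K 5
  have hQα : α ^ Q = -α := by
    rw [← Nat.sub_add_cancel hQ.le, pow_succ, h, neg_one_mul]
  have hT0 : T = 0 := Subtype.ext (by rw [hT, hQα]; simp)
  refine injective_oddQuintic_of_char_five fun s d _ hz => ?_
  have hz : d ^ 4 + N = 0 := by
    rw [hT0] at hz
    linear_combination hz
  have hz' : (d : K) ^ 4 = α ^ 2 := by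
    have := congrArg Subtype.val hz
    push_cast at this
    rw [hN, pow_succ α Q, hQα] at this
    linear_combination this
  rw [pow_sub_one_eq_one_of_pow_four hQ hF hα hz'] at h
  exact one_ne_zero (α := K) (by linear_combination -2 * h + h5)

theorem injective_of_pow_half_eq_neg_one [Fintype F] [CharP K 5] [CharP F 5] (hQ : 1 < Q)
    (hF : ∀ x, x ∈ F ↔ x ^ Q = x) (hFc : Fintype.card F = Q) (hodd : Q % 2 = 1) (hα : α ≠ 0)
    (hT : (T : K) = α + α ^ Q) (hN : (N : K) = α ^ (Q + 1)) (h : α ^ ((Q - 1) / 2) = -1) :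
    Function.Injective (oddQuintic T N) := by
  have h5 : (5 : F) = 0 := by exact_mod_cast CharP.cast_eq_zero F 5
  have h1 : α ^ (Q - 1) = 1 := by
    rw [show Q - 1 = (Q - 1) / 2 * 2 by omega, pow_mul, h]
    norm_num
  have hQα : α ^ Q = α := by
    rw [← Nat.sub_add_cancel hQ.le, pow_succ, h1, one_mul]
  obtain ⟨a, rfl⟩ : ∃ a : F, (a : K) = α := ⟨⟨α, (hF α).2 hQα⟩, rfl⟩
  have ha : a ≠ 0 := by rintro rfl; exact hα rfl
  have hns := (not_isSquare_iff_pow_half hFc ha hodd).2 h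
  have hTa : T = 2 * a :=
    (Subtype.ext (by rw [hT, hQα]; rfl) : T = a + a).trans (two_mul a).symm
  have hNa : N = a ^ 2 := Subtype.ext (by rw [hN, pow_succ, hQα]; push_cast; ring)
  -- For T = 2a and N = a² the quartic is (d² - a)² - as², so a zero with d ≠ 0 exhibits a as a
  -- square.
  refine injective_oddQuintic_of_char_five fun s d hd hz => hns ?_
  rw [hTa, hNa] at hz
  rcases eq_or_ne s 0 with rfl | hs
  · refine ⟨d, ?_⟩
    have : (d ^ 2 - a) ^ 2 = 0 := by linear_combination hz
    linear_combination -((pow_eq_zero_iff two_ne_zero).1 this)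
  · refine ⟨(d ^ 2 - a) / s, ?_⟩
    field_simp
    linear_combination -hz + a * s ^ 2 * h5

theorem pow_half_eq_neg_one_of_injective [Fintype F] [CharP F 5]
    (hF : ∀ x, x ∈ F ↔ x ^ Q = x) (hFc : Fintype.card F = Q) (hodd : Q % 2 = 1) (hα : α ≠ 0)
    (hT : (T : K) = α + α ^ Q) (hN : (N : K) = α ^ (Q + 1)) (hTN : T ^ 2 = 4 * N)
    (hg : Function.Injective (oddQuintic T N)) : α ^ ((Q - 1) / 2) = -1 := by
  have h5 : (5 : F) = 0 := by exact_mod_cast CharP.cast_eq_zero F 5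
  have hQα : α ^ Q = α := by
    have h1 : (T : K) ^ 2 = 4 * N := by
      have := congrArg F.subtype hTN
      rwa [map_pow, map_mul, map_ofNat] at this
    have h2 : (α ^ Q - α) ^ 2 = 0 := by
      rw [hT, hN] at h1
      linear_combination h1
    exact sub_eq_zero.1 ((pow_eq_zero_iff two_ne_zero).1 h2)
  obtain ⟨a, rfl⟩ : ∃ a : F, (a : K) = α := ⟨⟨α, (hF α).2 hQα⟩, rfl⟩
  have ha : a ≠ 0 := by rintro rfl; exact hα rfl
  rw [← not_isSquare_iff_pow_half hFc ha hodd]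
  rintro ⟨r, hr⟩
  have hTa : T = 2 * a :=
    (Subtype.ext (by rw [hT, hQα]; rfl) : T = a + a).trans (two_mul a).symm
  have hNa : N = a ^ 2 := Subtype.ext (by rw [hN, pow_succ, hQα]; push_cast; ring)
  -- Here g(y) = y(y² + a)², and (2r)² = -r² = -a, so 2r is a root of g.
  have h0 : 2 * r = 0 := hg (by
    rw [oddQuintic_zero, oddQuintic, hTa, hNa, hr]
    linear_combination 10 * r ^ 5 * h5)
  apply ha
  rw [hr]
  linear_combination 3 * r * h0 - r ^ 2 * h5

theorem injective_iff_of_char_five [Fintype F] [CharP K 5] [CharP F 5] (hQ25 : 25 ≤ Q)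
    (hF : ∀ x, x ∈ F ↔ x ^ Q = x) (hFc : Fintype.card F = Q) (hodd : Q % 2 = 1) (hα : α ≠ 0)
    (hT : (T : K) = α + α ^ Q) (hN : (N : K) = α ^ (Q + 1)) :
    Function.Injective (oddQuintic T N) ↔ α ^ (Q - 1) = -1 ∨ α ^ ((Q - 1) / 2) = -1 := by
  constructor
  · intro hg
    rcases eq_or_ne T 0 with h0 | h0
    · left
      rw [h0, ← Nat.sub_add_cancel (show 1 ≤ Q by omega), pow_succ] at hT
      apply mul_right_cancel₀ hα
      rw [ZeroMemClass.coe_zero] at hT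
      linear_combination -hT
    · right
      have hN0 : N ≠ 0 := by
        rintro rfl
        exact pow_ne_zero _ hα hN.symm
      exact pow_half_eq_neg_one_of_injective hF hFc hodd hα hT hN
        (sq_eq_of_char_five hFc hQ25 hodd h0 hN0 hg) hg
  · rintro (h | h)
    · exact injective_of_pow_eq_neg_one (by omega) hF hα hT hN h
    · exact injective_of_pow_half_eq_neg_one (by omega) hF hFc hodd hα hT hN h

theorem injective_iff_of_card_five [Fintype F] [CharP K 5] (hFc : Fintype.card F = 5)
    (hα : α ≠ 0) (hT : (T : K) = α + α ^ 5) (hN : (N : K) = α ^ 6) :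
    Function.Injective (oddQuintic T N) ↔
      (α ^ 4 = -1 ∨ α ^ 2 = -1) ∨ α ^ 4 - α ^ 2 + 1 = 0 := by
  have h5 : (5 : K) = 0 := by exact_mod_cast CharP.cast_eq_zero K 5
  have hT0 : T = 0 ↔ α ^ 4 = -1 := by
    rw [← ZeroMemClass.coe_eq_zero, hT, show α + α ^ 5 = α * (α ^ 4 + 1) by ring, mul_eq_zero,
      or_iff_right hα, add_eq_zero_iff_eq_neg]
  have hN1 : N = -1 ↔ α ^ 6 = -1 := by
    rw [Subtype.ext_iff, hN]
    rfl
  rw [injective_oddQuintic_iff_of_card_five hFc, Ne, Ne, hT0, hN1]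
  have h4 : α ^ 4 = -1 → α ^ 6 ≠ -1 := by
    intro h4 h6
    apply one_ne_zero (α := K)
    linear_combination 3 * ((1 + α ^ 2) * (h6 - α ^ 2 * h4) + h4) - h5
  have hfac : α ^ 6 = -1 ↔ α ^ 2 = -1 ∨ α ^ 4 - α ^ 2 + 1 = 0 := by
    rw [← add_eq_zero_iff_eq_neg, ← add_eq_zero_iff_eq_neg, ← mul_eq_zero]
    refine Eq.congr_left ?_
    ring
  tauto

end CharFive

/-! ### Assembling the cases -/

theorem exists_prime_pow_of_card {K : Type*} [Field K] [Fintype K] {Q : ℕ} (hQ : IsPrimePow Q)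
    (hK : Fintype.card K = Q ^ 2) : ∃ p n : ℕ, p.Prime ∧ CharP K p ∧ Q = p ^ n := by
  obtain ⟨r, k, hr, hk, rfl⟩ := (isPrimePow_nat_iff Q).1 hQ
  obtain ⟨p, hp⟩ := CharP.exists K
  obtain ⟨m, hpp, hm⟩ := FiniteField.card K p
  refine ⟨p, k, hpp, hp, ?_⟩
  have : p ∣ r := by
    apply hpp.dvd_of_dvd_pow (n := k * 2)
    rw [pow_mul, ← hK, hm]
    exact dvd_pow_self p m.ne_zero
  rw [(Nat.prime_dvd_prime_iff_eq hpp hr).1 this]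

theorem exists_subfield_card {K : Type*} [Field K] [Fintype K] {p n Q : ℕ} [Fact p.Prime]
    [CharP K p] (hQn : Q = p ^ n) (hQ : 1 < Q) (hK : Fintype.card K = Q ^ 2) :
    ∃ F : Subfield K, (∀ x, x ∈ F ↔ x ^ Q = x) ∧ Nat.card F = Q := by
  refine ⟨(iterateFrobenius K p n).eqLocusField (RingHom.id K), ?_, ?_⟩
  · intro x
    rw [hQn]
    rfl
  · have h := ncard_pow_eq_self hQ hK
    rw [← Nat.card_coe_set_eq, hQn] at h
    rw [hQn]
    exact h

theorem isPermutationPolynomial_iff_cases {K : Type*} [Field K] [Fintype K] {Q : ℕ}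
    (hQ : IsPrimePow Q) (hK : Fintype.card K = Q ^ 2) {α : K} (hα : α ≠ 0) :
    IsPermutationPolynomial
      (Polynomial.X ^ (2 * Q + 3) + Polynomial.C α * Polynomial.X : Polynomial K) ↔
      ((Q % 5 = 2 ∨ Q % 5 = 3) ∧ α ^ (2 * Q - 2) - 3 * α ^ (Q - 1) + 1 = 0) ∨
      ((∃ n : ℕ, Q = 5 ^ n) ∧ (α ^ (Q - 1) = -1 ∨ α ^ ((Q - 1) / 2) = -1)) ∨
      (Q = 13 ∧ α ^ 12 - 3 * α ^ 6 + 1 = 0) ∨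
      (Q = 5 ∧ α ^ 4 - α ^ 2 + 1 = 0) ∨
      (Q = 3 ∧ (α = 1 ∨ α ^ 2 = -1)) := by
  obtain ⟨p, n, hpp, hp, hQn⟩ := exists_prime_pow_of_card hQ hK
  have : Fact p.Prime := ⟨hpp⟩
  have hQ1 : 1 < Q := hQ.one_lt
  obtain ⟨F, hF, hFc⟩ := exists_subfield_card hQn hQ1 hK
  have : Fintype F := Fintype.ofFinite F
  rw [Nat.card_eq_fintype_card] at hFc
  have hpF : CharP F p := F.subtype.charP F.subtype.injective p
  have hαQ : α ^ (Q ^ 2) = α := by rw [← hK, FiniteField.pow_card]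
  have hTF : α + α ^ Q ∈ F := by
    rw [hF]
    have := add_pow_char_pow (p := p) (n := n) α (α ^ Q)
    rw [← hQn] at this
    rw [this, ← pow_mul, ← pow_two, hαQ, add_comm]
  have hNF : α ^ (Q + 1) ∈ F := by
    rw [hF, ← pow_mul, show (Q + 1) * Q = Q ^ 2 + Q by ring, pow_add, hαQ, pow_succ']
  obtain ⟨T, hT⟩ : ∃ T : F, (T : K) = α + α ^ Q := ⟨⟨_, hTF⟩, rfl⟩
  obtain ⟨N, hN⟩ : ∃ N : F, (N : K) = α ^ (Q + 1) := ⟨⟨_, hNF⟩, rfl⟩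
  rw [isPermutationPolynomial_iff hQn hQ1 hK hF hT hN]
  have h5n : ∀ m, Q = 5 ^ m → Q % 5 = 0 := by
    intro m hm
    -- The exponent 0 is allowed in the case condition, but Q > 1 excludes it.
    have : m ≠ 0 := by rintro rfl; simp [hm] at hQ1
    rw [hm]
    exact Nat.mod_eq_zero_of_dvd (dvd_pow_self 5 this)
  have hsq := sq_eq_five_mul_iff (F := F) hQ1 hα hT hN
  have hmod := Nat.mod_lt Q (show 5 > 0 by norm_num)
  by_cases h0 : Q % 5 = 0
  · have hp5 : p = 5 := by
      have : 5 ∣ p := Nat.prime_five.dvd_of_dvd_pow (hQn ▸ Nat.dvd_of_mod_eq_zero h0)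
      exact ((Nat.prime_dvd_prime_iff_eq Nat.prime_five hpp).1 this).symm
    subst hp5
    have hodd : Q % 2 = 1 := by
      rw [hQn]
      exact Nat.odd_iff.1 (Odd.pow (by decide))
    by_cases hQ5 : Q = 5
    · subst hQ5
      rw [injective_iff_of_card_five hFc hα hT hN]
      have : ∃ n, 5 = 5 ^ n := ⟨1, rfl⟩
      norm_num [this]
    · have h25 : 25 ≤ Q := by
        have : 2 ≤ n := by
          by_contra h
          interval_cases n
          · simp [hQn] at hQ1
          · exact hQ5 (by simpa using hQn)
        rw [hQn]
        calc 25 = 5 ^ 2 := by norm_num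
          _ ≤ 5 ^ n := Nat.pow_le_pow_right (by norm_num) this
      rw [injective_iff_of_char_five h25 hF hFc hodd hα hT hN]
      have h3 : Q ≠ 3 := by omega
      have h13 : Q ≠ 13 := by omega
      have h5e : ∃ n, Q = 5 ^ n := ⟨n, hQn⟩
      simp [h0, h3, h13, hQ5, h5e]
  have h5e : ¬ ∃ n, Q = 5 ^ n := fun ⟨m, hm⟩ => h0 (h5n m hm)
  have hQ5 : Q ≠ 5 := by rintro rfl; exact h0 rfl
  by_cases h23 : Q % 5 = 2 ∨ Q % 5 = 3
  · simp only [h5e, hQ5, h23, true_and, false_and, false_or]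
    by_cases h3 : Q = 3
    · subst h3
      have h3K : (3 : K) = 0 := by
        have h := FiniteField.cast_card_eq_zero F
        rw [hFc] at h
        have := congrArg F.subtype h
        rwa [map_natCast, map_zero] at this
      rw [injective_iff_of_card_three hF hαQ hα hT hN h3K]
      norm_num
    by_cases h13 : Q = 13
    · subst h13
      obtain rfl : p = 13 := by
        have : p ∣ 13 := (CharP.cast_eq_zero_iff F p 13).1 (by
          have := FiniteField.cast_card_eq_zero F
          rwa [hFc] at this)
        exact (Nat.prime_dvd_prime_iff_eq hpp (by norm_num)).1 this
      rw [injective_iff_of_card_thirteen hF hFc hα hT hN, hsq]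
      simp
    · simp only [h3, h13, false_and, or_false]
      rw [← hsq]
      exact ⟨sq_eq_of_injective_of_mod_two_or_three hQn hQ1 hF hFc h23 h3 h13 hα hT hN,
        injective_of_sq_eq_five_mul hQn hF h23⟩
  · have h3 : Q ≠ 3 := by omega
    have h13 : Q ≠ 13 := by omega
    simp only [h5e, hQ5, h23, h3, h13, false_and, or_false, iff_false]
    by_cases h1 : Q % 5 = 1
    · exact not_injective_oddQuintic_of_mod_one hFc h1 hQ1
    · exact not_injective_oddQuintic_of_mod_four hQn hFc (by omega) hα hT hN

theorem corollary2p5 {K : Type*} [Field K] (Q : ℕ) (hQ : IsPrimePow Q)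
    (hK : Nat.card K = Q ^ 2) :
    (∀ α : K, α ≠ 0 →
      (IsPermutationPolynomial
          (Polynomial.X ^ (2 * Q + 3) + Polynomial.C α * Polynomial.X : Polynomial K) ↔
        (((Q : ℤ) ≡ 2 [ZMOD 5] ∨ (Q : ℤ) ≡ -2 [ZMOD 5]) ∧
            α ^ (2 * Q - 2) - 3 * α ^ (Q - 1) + 1 = 0) ∨
        ((∃ n : ℕ, Q = 5 ^ n) ∧ (α ^ (Q - 1) = -1 ∨ α ^ ((Q - 1) / 2) = -1)) ∨
        (Q = 13 ∧ α ^ 12 - 3 * α ^ 6 + 1 = 0) ∨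
        (Q = 5 ∧ α ^ 4 - α ^ 2 + 1 = 0) ∨
        (Q = 3 ∧ (α = 1 ∨ α ^ 2 = -1)))) ∧
    (((Q : ℤ) ≡ 2 [ZMOD 5] ∨ (Q : ℤ) ≡ -2 [ZMOD 5]) →
      {α : K | α ^ (2 * Q - 2) - 3 * α ^ (Q - 1) + 1 = 0}.ncard = 2 * Q - 2) ∧
    ((∃ n : ℕ, Q = 5 ^ n) →
      {α : K | α ^ (Q - 1) = -1 ∨ α ^ ((Q - 1) / 2) = -1}.ncard = 3 * (Q - 1) / 2) ∧
    (Q = 13 → {α : K | α ^ 12 - 3 * α ^ 6 + 1 = 0}.ncard = 12) ∧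
    (Q = 5 → {α : K | α ^ 4 - α ^ 2 + 1 = 0}.ncard = 4) ∧
    (Q = 3 → {α : K | α = 1 ∨ α ^ 2 = -1}.ncard = 3) := by
  have hQ1 : 1 < Q := hQ.one_lt
  have : Finite K := Nat.finite_of_card_ne_zero (by rw [hK]; positivity)
  have : Fintype K := Fintype.ofFinite K
  rw [Nat.card_eq_fintype_card] at hK
  have hmod : ((Q : ℤ) ≡ 2 [ZMOD 5] ∨ (Q : ℤ) ≡ -2 [ZMOD 5]) ↔ (Q % 5 = 2 ∨ Q % 5 = 3) := by
    simp only [Int.ModEq]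
    omega
  simp only [hmod]
  refine ⟨fun α hα => isPermutationPolynomial_iff_cases hQ hK hα, ?_, ?_, ?_, ?_, ?_⟩
  · intro h
    obtain ⟨p, n, hpp, hp, hQn⟩ := exists_prime_pow_of_card hQ hK
    have : Fact p.Prime := ⟨hpp⟩
    exact ncard_golden p hQ1 hQn hK h
  · rintro ⟨n, hn⟩
    refine ncard_pow_eq_neg_one hQ1 ?_ hK
    rw [hn]
    exact Nat.odd_iff.1 (Odd.pow (by decide))
  · rintro rfl
    exact ncard_of_card_thirteen_sq hK
  · rintro rfl
    exact ncard_of_card_five_sq hK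
  · rintro rfl
    exact ncard_of_card_three_sq hK
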